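/- Let $G\rightrightarrows M$ be a Lie groupoid with source $s$ and target $t$ ($M$ a Hausdorff smooth manifold, $G$ a smooth manifold, not necessarily Hausdorff; all structure maps smooth, $s,t$ submersions). A \emph{$G$-path} from $x$ to $y$ is a sequence $\sigma=\sigma_ng_n\sigma_{n-1}\cdots\sigma_1g_1\sigma_0$ ($n\ge 0$) of piecewise smooth paths $\sigma_j:[0,1]\to M$ and arrows $g_j:\sigma_{j-1}(1)\to\sigma_j(0)$ with $\sigma_0(0)=x$, $\sigma_n(1)=y$. \emph{$G$-homotopy} is the equivalence relation on $G$-paths from $x$ to $y$ generated by (i) $\cdots g_{j+1}\sigma_jg_j\cdots\sim\cdots (g_{j+1}g_j)\cdots$ if $\sigma_j$ is constant ($0<j<n$); (ii) $\cdots\sigma_jg_j\sigma_{j-1}\cdots\sim\cdots(\sigma_j\cdot\sigma_{j-1})\cdots$ if $g_j$ is a unit ($1\le j\le n$), where $\sigma_j\cdot\sigma_{j-1}$ is the standard concatenation, $\sigma_{j-1}$ first; (iii) deformations, i.e. families $D_n(\tau,\cdot)d_n(\tau)\cdots d_1(\tau)D_0(\tau,\cdot)$, $\tau\in[0,1]$,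 of $G$-paths of constant order from $x$ to $y$ with all $D_j:[0,1]^2\to M$ and $d_j:[0,1]\to G$ continuous. The classes of $G$-paths from $x_0$ to $x_0$ form the fundamental group $\Pi_1(G,x_0)$, with multiplication induced by the concatenation $\sigma'\,1\,\sigma$. The groupoid is \emph{$G$-connected} if any two points of $M$ are joined by a $G$-path. A \emph{covering space over $G$} is a smooth covering $r:F\to M$ with a smooth right action of $G$ along $r$ ($e\cdot g$ is defined when $r(e)=t(g)$, and $r(e\cdot g)=s(g)$). Its action groupoid $F\rtimes G\rightrightarrows F$ has as arrows the pairs $(e,g)\in F\times_MG$, from $e\cdot g$ to $e$, and the morphism $(e,g)\mapsto g$ over $r$ induces $r_*:\Pi_1(F\rtimes G,e_0)\to\Pi_1(G,r(e_0))$. \textbf{Proposition.} Assume that $G\rightrightarrows M$ is $G$-connected and let $x_0\in M$. For every subgroup $H$ of $\Pi_1(G,x_0)$ there are a covering space $r:F\to M$ over $G$, with $F$ a Hausdorff smooth manifold (second countable if $M$ and $G$ are) and $F\rtimes G$ being $(F\rtimes G)$-connected, and a point $e_0\in F$ with $r(e_0)=x_0$, such that $$r_*\bigl(\Pi_1(F\rtimes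 G,e_0)\bigr)=H .$$ -/

import Mathlib

open scoped Manifold ContDiff
open Function

universe u v w

namespace LieGpd

/-! ### Groupoids and Lie groupoids -/

/-- A groupoid with set of objects `M` and set of arrows `A`; an arrow `g` goes from `src g` to
`tgt g`, and `mul g h` (first `h`, then `g`) is meaningful when `src g = tgt h`: the values of
`mul` on pairs which are not composable are irrelevant. -/
structure Gpd (M : Type u) (A : Type v) where
  src : A → M
  tgt : A → M
  one : M → A
  mul : A → A → A
  inv : A → A
  src_one : ∀ x, src (one x) = x
  tgt_one : ∀ x, tgt (one x) = x
  src_mul : ∀ g h, src g = tgt h → src (mul g h) = src h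
  tgt_mul : ∀ g h, src g = tgt h → tgt (mul g h) = tgt g
  mul_assoc : ∀ g h k, src g = tgt h → src h = tgt k → mul (mul g h) k = mul g (mul h k)
  one_mul : ∀ g, mul (one (tgt g)) g = g
  mul_one : ∀ g, mul g (one (src g)) = g
  src_inv : ∀ g, src (inv g) = tgt g
  tgt_inv : ∀ g, tgt (inv g) = src g
  inv_mul : ∀ g, mul (inv g) g = one (src g)
  mul_inv : ∀ g, mul g (inv g) = one (tgt g)

/-- A Lie groupoid `A ⇉ M`, where `M` and `A` are smooth manifolds without boundary, modelled on
`E` and `E'`: the source and the target are submersions and all structure maps are smooth. The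
composable pairs form an embedded submanifold of `A × A`, so that smoothness of the multiplication
is smoothness on this subset. -/
structure LieGroupoid (E : Type*) [NormedAddCommGroup E] [NormedSpace ℝ E]
    (E' : Type*) [NormedAddCommGroup E'] [NormedSpace ℝ E']
    (M : Type u) [TopologicalSpace M] [ChartedSpace E M]
    (A : Type v) [TopologicalSpace A] [ChartedSpace E' A] extends Gpd M A where
  smooth_src : ContMDiff 𝓘(ℝ, E') 𝓘(ℝ, E) ∞ src
  smooth_tgt : ContMDiff 𝓘(ℝ, E') 𝓘(ℝ, E) ∞ tgt
  submersion_src : ∀ g, Surjective (mfderiv 𝓘(ℝ, E') 𝓘(ℝ, E) src g)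
  submersion_tgt : ∀ g, Surjective (mfderiv 𝓘(ℝ, E') 𝓘(ℝ, E) tgt g)
  smooth_one : ContMDiff 𝓘(ℝ, E) 𝓘(ℝ, E') ∞ one
  smooth_inv : ContMDiff 𝓘(ℝ, E') 𝓘(ℝ, E') ∞ inv
  smooth_mul : ContMDiffOn (𝓘(ℝ, E').prod 𝓘(ℝ, E')) 𝓘(ℝ, E') ∞
    (fun p : A × A => mul p.1 p.2) {p : A × A | src p.1 = tgt p.2}

/-! ### Piecewise smooth paths -/

section Paths

variable (E : Type*) [NormedAddCommGroup E] [NormedSpace ℝ E]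
  {M : Type u} [TopologicalSpace M] [ChartedSpace E M]

/-- A path is piecewise smooth if it is continuous and there is a finite set of break points such
that it is smooth on each closed subinterval of `[0,1]` with no break point in its interior. -/
def PiecewiseSmooth (σ : unitInterval → M) : Prop :=
  Continuous σ ∧ ∃ S : Finset ℝ, ∀ a b : ℝ, 0 ≤ a → a < b → b ≤ 1 → (∀ c ∈ S, c ∉ Set.Ioo a b) →
    ContMDiffOn 𝓘(ℝ, ℝ) 𝓘(ℝ, E) ∞ (Set.IccExtend (zero_le_one (α := ℝ)) σ) (Set.Icc a b)

/-- The standard concatenation: first `σ`, then `τ`. -/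
noncomputable def concat {M : Type u} (σ τ : unitInterval → M) : unitInterval → M := fun t =>
  if (t : ℝ) ≤ 1 / 2 then Set.IccExtend (zero_le_one (α := ℝ)) σ (2 * t)
  else Set.IccExtend (zero_le_one (α := ℝ)) τ (2 * t - 1)

end Paths

/-! ### Paths of a groupoid and their homotopy classes -/

/-- The data of a sequence `σₙ gₙ σₙ₋₁ ⋯ σ₁ g₁ σ₀`: the path `head = σ₀` and the list
`tail = [(g₁, σ₁), …, (gₙ, σₙ)]`. -/
@[ext] structure RawGPath (M : Type u) (A : Type v) where
  head : unitInterval → M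
  tail : List (A × (unitInterval → M))

/-- The end point `σₙ(1)`. -/
def endOf {M : Type u} {A : Type v} : (unitInterval → M) → List (A × (unitInterval → M)) → M
  | σ, [] => σ 1
  | _, (_, τ) :: l => endOf τ l

section GPaths

variable (E : Type*) [NormedAddCommGroup E] [NormedSpace ℝ E]
  {M : Type u} [TopologicalSpace M] [ChartedSpace E M] {A : Type v} (G : Gpd M A)

/-- The paths `σ₀, …, σₙ` are piecewise smooth and `gⱼ` is an arrow from `σⱼ₋₁(1)` to `σⱼ(0)`. -/
def IsChain : (unitInterval → M) → List (A × (unitInterval → M)) → Prop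
  | σ, [] => PiecewiseSmooth E σ
  | σ, (g, τ) :: l =>
      PiecewiseSmooth E σ ∧ G.src g = σ 1 ∧ G.tgt g = τ 0 ∧ IsChain τ l

/-- `p` is a `G`-path from `x` to `y`. -/
def IsGPath (x y : M) (p : RawGPath M A) : Prop :=
  IsChain E G p.head p.tail ∧ p.head 0 = x ∧ endOf p.head p.tail = y

/-- The `G`-paths from `x` to `y`. -/
def GPath (x y : M) : Type (max u v) := {p : RawGPath M A // IsGPath E G x y p}

/-- `G`-connectedness: any two points are joined by a `G`-path. -/
def Connected : Prop := ∀ x y : M, Nonempty (GPath E G x y)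

/-- The member at time `τ` of a family of sequences
`Dₙ(τ,·) dₙ(τ) Dₙ₋₁(τ,·) ⋯ d₁(τ) D₀(τ,·)`. -/
def familyAt {M : Type u} {A : Type v} (D₀ : unitInterval → unitInterval → M) (T : List ((unitInterval → A) × (unitInterval → unitInterval → M)))
    (τ : unitInterval) : RawGPath M A :=
  ⟨D₀ τ, T.map fun e => (e.1 τ, e.2 τ)⟩

variable [TopologicalSpace A]

/-- There is a deformation from `p` to `q`, i.e. a continuous family, of constant order, of
`G`-paths from `x` to `y`, which starts at `p` and ends at `q`. -/
def IsDeformation (x y : M) (p q : RawGPath M A) : Prop :=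
  ∃ (D₀ : unitInterval → unitInterval → M) (T : List ((unitInterval → A) × (unitInterval → unitInterval → M))),
    Continuous (uncurry D₀) ∧ (∀ e ∈ T, Continuous e.1 ∧ Continuous (uncurry e.2)) ∧
    (∀ τ, IsGPath E G x y (familyAt D₀ T τ)) ∧ familyAt D₀ T 0 = p ∧ familyAt D₀ T 1 = q

/-- The elementary moves between `G`-paths: multiplication equivalence, concatenation equivalence
(at the initial path, or at a later one), and deformation. -/
inductive RawStep (x y : M) : RawGPath M A → RawGPath M A → Prop
  | mul (σ : unitInterval → M) (l₁ : List (A × (unitInterval → M))) (g : A) (c : unitInterval → M) (h : A) (τ : unitInterval → M)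
      (l₂ : List (A × (unitInterval → M))) (hc : ∀ t, c t = c 0) (hgh : G.src h = G.tgt g) :
      RawStep x y ⟨σ, l₁ ++ (g, c) :: (h, τ) :: l₂⟩ ⟨σ, l₁ ++ (G.mul h g, τ) :: l₂⟩
  | concat_head (σ τ : unitInterval → M) (l : List (A × (unitInterval → M))) :
      RawStep x y ⟨σ, (G.one (σ 1), τ) :: l⟩ ⟨concat σ τ, l⟩
  | concat_tail (σ : unitInterval → M) (l₁ : List (A × (unitInterval → M))) (g : A) (α β : unitInterval → M)
      (l₂ : List (A × (unitInterval → M))) :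
      RawStep x y ⟨σ, l₁ ++ (g, α) :: (G.one (α 1), β) :: l₂⟩ ⟨σ, l₁ ++ (g, concat α β) :: l₂⟩
  | deform (p q : RawGPath M A) (h : IsDeformation E G x y p q) : RawStep x y p q

/-- The `G`-homotopy classes of `G`-paths from `x` to `y`: `G`-homotopy is the equivalence
relation generated by the elementary moves. -/
def HClass (x y : M) : Type (max u v) :=
  Quot fun p q : GPath E G x y => RawStep E G x y p.1 q.1

/-- The fundamental group of `G` at `x`, as a set: the `G`-homotopy classes of `G`-loops. -/
def FundGroup (x : M) : Type (max u v) := HClass E G x x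

end GPaths

/-! ### Basic facts on piecewise smooth paths -/

section PathFacts

variable {E : Type*} [NormedAddCommGroup E] [NormedSpace ℝ E]
  {M : Type u} [TopologicalSpace M] [ChartedSpace E M]

theorem PiecewiseSmooth.const (x : M) : PiecewiseSmooth E (fun _ : unitInterval => x) := by
  refine ⟨continuous_const, ∅, fun a b _ _ _ _ => ?_⟩
  exact contMDiffOn_const

/-- Reparametrisation by a map which is affine on both halves of `[0,1]`. -/
theorem PiecewiseSmooth.reparam {σ : unitInterval → M} (hσ : PiecewiseSmooth E σ) (φ : unitInterval → unitInterval)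
    (k m k' m' : ℝ) (h₁ : ∀ t : unitInterval, (t : ℝ) ≤ 1 / 2 → (φ t : ℝ) = k * t + m)
    (h₂ : ∀ t : unitInterval, 1 / 2 ≤ (t : ℝ) → (φ t : ℝ) = k' * t + m') :
    PiecewiseSmooth E (fun t => σ (φ t)) := by
  obtain ⟨hc, S, hS⟩ := hσ
  have hφ : Continuous φ := by
    have : Continuous fun t : unitInterval =>
        if (t : ℝ) ≤ 1 / 2 then k * (t : ℝ) + m else k' * (t : ℝ) + m' := by
      refine Continuous.if_le (by fun_prop) (by fun_prop) (by fun_prop) (by fun_prop) ?_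
      intro t ht
      rw [← h₁ t ht.le, ← h₂ t ht.ge]
    rw [continuous_induced_rng]
    convert this using 2 with t
    simp only [comp_apply]
    split_ifs with h
    · exact h₁ t h
    · exact h₂ t (not_le.1 h).le
  -- smoothness on a subinterval where the reparametrisation is affine
  have key : ∀ (k m a b : ℝ), 0 ≤ a → a < b → b ≤ 1 →
      (∀ t : unitInterval, (t : ℝ) ∈ Set.Icc a b → (φ t : ℝ) = k * t + m) →
      (∀ c ∈ S, (c - m) / k ∉ Set.Ioo a b) →
      ContMDiffOn 𝓘(ℝ, ℝ) 𝓘(ℝ, E) ∞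
        (Set.IccExtend (zero_le_one (α := ℝ)) fun t => σ (φ t)) (Set.Icc a b) := by
    intro k m a b ha hab hb haff hmiss
    have hval : ∀ u ∈ Set.Icc a b, ∃ h : k * u + m ∈ Set.Icc (0 : ℝ) 1,
        Set.IccExtend (zero_le_one (α := ℝ)) (fun t => σ (φ t)) u = σ ⟨k * u + m, h⟩ := by
      intro u hu
      have hu' : u ∈ Set.Icc (0 : ℝ) 1 := ⟨ha.trans hu.1, hu.2.trans hb⟩
      have e := haff ⟨u, hu'⟩ hu
      refine ⟨by rw [← show ((φ ⟨u, hu'⟩ : unitInterval) : ℝ) = k * u + m from e]; exact (φ ⟨u, hu'⟩).2, ?_⟩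
      rw [Set.IccExtend_of_mem _ _ hu']
      congr 1
      exact Subtype.ext e
    have heq : ∀ u ∈ Set.Icc a b, Set.IccExtend (zero_le_one (α := ℝ)) (fun t => σ (φ t)) u =
        (Set.IccExtend (zero_le_one (α := ℝ)) σ ∘ fun u => k * u + m) u := by
      intro u hu
      obtain ⟨h, e⟩ := hval u hu
      rw [e, comp_apply, Set.IccExtend_of_mem _ _ h]
    have hsm : ContMDiffOn 𝓘(ℝ, ℝ) 𝓘(ℝ, ℝ) ∞ (fun u : ℝ => k * u + m) (Set.Icc a b) := by
      apply ContDiffOn.contMDiffOn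
      fun_prop
    obtain ⟨ha', -⟩ := hval a ⟨le_rfl, hab.le⟩
    obtain ⟨hb', -⟩ := hval b ⟨hab.le, le_rfl⟩
    rcases lt_trichotomy k 0 with hk | hk | hk
    · refine ContMDiffOn.congr (ContMDiffOn.comp (t := Set.Icc (k * b + m) (k * a + m))
        (hS _ _ hb'.1 ?_ ha'.2 ?_) hsm ?_) heq
      · nlinarith
      · intro c hcS hcI
        apply hmiss c hcS
        constructor
        · rw [lt_div_iff_of_neg hk]; linarith [hcI.2]
        · rw [div_lt_iff_of_neg hk]; linarith [hcI.1]
      · intro u hu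
        constructor <;> nlinarith [hu.1, hu.2]
    · subst hk
      obtain ⟨h, -⟩ := hval a ⟨le_rfl, hab.le⟩
      refine ContMDiffOn.congr (contMDiffOn_const (c := σ ⟨0 * a + m, h⟩)) ?_
      intro u hu
      obtain ⟨h', e⟩ := hval u hu
      rw [e]
      congr 2
      ring
    · refine ContMDiffOn.congr (ContMDiffOn.comp (t := Set.Icc (k * a + m) (k * b + m))
        (hS _ _ ha'.1 ?_ hb'.2 ?_) hsm ?_) heq
      · nlinarith
      · intro c hcS hcI
        apply hmiss c hcS
        constructor
        · rw [lt_div_iff₀ hk]; linarith [hcI.1]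
        · rw [div_lt_iff₀ hk]; linarith [hcI.2]
      · intro u hu
        constructor <;> nlinarith [hu.1, hu.2]
  classical
  refine ⟨hc.comp hφ, {1 / 2} ∪ S.image (fun c => (c - m) / k) ∪
    S.image (fun c => (c - m') / k'), ?_⟩
  intro a b ha hab hb hmiss
  have hhalf : ¬ (a < 1 / 2 ∧ 1 / 2 < b) := hmiss (1 / 2) (by simp)
  by_cases hb2 : b ≤ 1 / 2
  · refine key k m a b ha hab hb (fun t ht => h₁ t (ht.2.trans hb2)) fun c hc => ?_
    exact hmiss _ (by simp only [Finset.mem_union, Finset.mem_image]; exact .inl (.inr ⟨c, hc, rfl⟩))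
  · have ha2 : 1 / 2 ≤ a := by
      by_contra h
      exact hhalf ⟨not_le.1 h, not_le.1 hb2⟩
    refine key k' m' a b ha hab hb (fun t ht => h₂ t (ha2.trans ht.1)) fun c hc => ?_
    exact hmiss _ (by simp only [Finset.mem_union, Finset.mem_image]; exact .inr ⟨c, hc, rfl⟩)

theorem PiecewiseSmooth.symm {σ : unitInterval → M} (hσ : PiecewiseSmooth E σ) :
    PiecewiseSmooth E (fun t => σ (unitInterval.symm t)) :=
  hσ.reparam _ (-1) 1 (-1) 1 (fun t _ => by simp; ring) (fun t _ => by simp; ring)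

/-- Smooth maps send piecewise smooth paths to piecewise smooth paths. -/
theorem PiecewiseSmooth.map {N : Type w} [TopologicalSpace N] [ChartedSpace E N] {σ : unitInterval → M}
    (hσ : PiecewiseSmooth E σ) {f : M → N} (hf : ContMDiff 𝓘(ℝ, E) 𝓘(ℝ, E) ∞ f) :
    PiecewiseSmooth E (fun t => f (σ t)) := by
  obtain ⟨hc, S, hS⟩ := hσ
  refine ⟨hf.continuous.comp hc, S, fun a b ha hab hb h => ?_⟩
  exact hf.comp_contMDiffOn (hS a b ha hab hb h)

/-- The tent function `t ↦ τ + (1 - τ) |2 t - 1|`. -/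
noncomputable def tent (τ t : unitInterval) : unitInterval :=
  ⟨τ + (1 - τ) * |2 * (t : ℝ) - 1|, by
    have h1 := τ.2.1; have h2 := τ.2.2; have h3 := t.2.1; have h4 := t.2.2
    have h5 : |2 * (t : ℝ) - 1| ≤ 1 := abs_le.2 ⟨by linarith, by linarith⟩
    have h6 := abs_nonneg (2 * (t : ℝ) - 1)
    constructor <;> nlinarith⟩

theorem continuous_tent : Continuous (uncurry tent) := by
  rw [continuous_induced_rng]
  simp only [Function.comp_def, uncurry, tent]
  fun_prop

/-- The function `t ↦ τ t + (1 - τ) max(2 t - 1, 0)`. -/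
noncomputable def delay (τ t : unitInterval) : unitInterval :=
  ⟨τ * t + (1 - τ) * max (2 * (t : ℝ) - 1) 0, by
    have h1 := τ.2.1; have h2 := τ.2.2; have h3 := t.2.1; have h4 := t.2.2
    have h5 : max (2 * (t : ℝ) - 1) 0 ≤ 1 := max_le (by linarith) (by linarith)
    have h6 : 0 ≤ max (2 * (t : ℝ) - 1) 0 := le_max_right _ _
    constructor <;> nlinarith⟩

theorem continuous_delay : Continuous (uncurry delay) := by
  rw [continuous_induced_rng]
  simp only [Function.comp_def, uncurry, delay]
  fun_prop

theorem PiecewiseSmooth.tent {σ : unitInterval → M} (hσ : PiecewiseSmooth E σ) (τ : unitInterval) :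
    PiecewiseSmooth E (fun t => σ (tent τ t)) := by
  refine hσ.reparam _ (-2 * (1 - τ)) 1 (2 * (1 - τ)) (2 * τ - 1) (fun t ht => ?_) fun t ht => ?_
  · simp only [LieGpd.tent]
    rw [abs_of_nonpos (by linarith)]
    ring
  · simp only [LieGpd.tent]
    rw [abs_of_nonneg (by linarith)]
    ring

theorem PiecewiseSmooth.delay {σ : unitInterval → M} (hσ : PiecewiseSmooth E σ) (τ : unitInterval) :
    PiecewiseSmooth E (fun t => σ (delay τ t)) := by
  refine hσ.reparam _ τ 0 (τ + 2 * (1 - τ)) (-(1 - τ)) (fun t ht => ?_) fun t ht => ?_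
  · simp only [LieGpd.delay]
    rw [max_eq_right (by linarith)]
    ring
  · simp only [LieGpd.delay]
    rw [max_eq_left (by linarith)]
    ring

theorem concat_symm_self {M : Type u} (σ : unitInterval → M) :
    concat (fun t => σ (unitInterval.symm t)) σ = fun t => σ (tent 0 t) := by
  funext t
  have h3 := t.2.1; have h4 := t.2.2
  unfold concat
  split_ifs with h
  · have h' : 2 * (t : ℝ) ∈ Set.Icc (0 : ℝ) 1 := ⟨by linarith, by linarith⟩
    rw [Set.IccExtend_of_mem _ _ h']
    congr 1
    ext
    simp only [LieGpd.tent, unitInterval.symm]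
    rw [abs_of_nonpos (by linarith)]
    simp
  · have h' : 2 * (t : ℝ) - 1 ∈ Set.Icc (0 : ℝ) 1 := ⟨by linarith, by linarith⟩
    rw [Set.IccExtend_of_mem _ _ h']
    congr 1
    ext
    simp only [LieGpd.tent]
    rw [abs_of_nonneg h'.1]
    simp

theorem concat_const {M : Type u} (σ : unitInterval → M) :
    concat (fun _ => σ 0) σ = fun t => σ (delay 0 t) := by
  funext t
  have h3 := t.2.1; have h4 := t.2.2
  unfold concat
  split_ifs with h
  · have : delay 0 t = 0 := by
      ext
      simp only [LieGpd.delay]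
      rw [max_eq_right (by linarith)]
      simp
    rw [this]
    rfl
  · have h' : 2 * (t : ℝ) - 1 ∈ Set.Icc (0 : ℝ) 1 := ⟨by linarith, by linarith⟩
    rw [Set.IccExtend_of_mem _ _ h']
    congr 1
    ext
    simp only [LieGpd.delay]
    rw [max_eq_left h'.1]
    simp

theorem map_concat {M : Type u} {N : Type w} (f : M → N) (σ τ : unitInterval → M) :
    (fun t => f (concat σ τ t)) = concat (fun t => f (σ t)) (fun t => f (τ t)) := by
  funext t
  unfold concat
  split_ifs <;> rfl

end PathFacts

/-! ### Concatenation of `G`-paths and the group structure -/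

section Lists

variable {M : Type u} {A : Type v}

@[simp] theorem endOf_append (σ : unitInterval → M) (l₁ : List (A × (unitInterval → M))) (g : A) (τ : unitInterval → M)
    (l₂ : List (A × (unitInterval → M))) : endOf σ (l₁ ++ (g, τ) :: l₂) = endOf τ l₂ := by
  induction l₁ generalizing σ with
  | nil => rfl
  | cons e l ih => exact ih e.2

/-- The concatenation `q₀ … 1 … p₀`: first `p`, then `q`. -/
def RawGPath.comp (G : Gpd M A) (p q : RawGPath M A) : RawGPath M A :=
  ⟨p.head, p.tail ++ (G.one (endOf p.head p.tail), q.head) :: q.tail⟩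

/-- The reversed sequence, with inverted arrows. -/
def revAux (G : Gpd M A) : (unitInterval → M) → List (A × (unitInterval → M)) → RawGPath M A
  | σ, [] => ⟨fun t => σ (unitInterval.symm t), []⟩
  | σ, (g, τ) :: l =>
      ⟨(revAux G τ l).head,
        (revAux G τ l).tail ++ [(G.inv g, fun t => σ (unitInterval.symm t))]⟩

theorem endOf_revAux (G : Gpd M A) (σ : unitInterval → M) (l : List (A × (unitInterval → M))) :
    endOf (revAux G σ l).head (revAux G σ l).tail = σ 0 := by
  cases l with
  | nil => simp [revAux, endOf]
  | cons e l => simp [revAux, endOf]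

theorem head_revAux (G : Gpd M A) (σ : unitInterval → M) (l : List (A × (unitInterval → M))) :
    (revAux G σ l).head 0 = endOf σ l := by
  induction l generalizing σ with
  | nil => simp [revAux, endOf]
  | cons e l ih => simpa [revAux, endOf] using ih e.2

end Lists

section GroupStructure

variable {E : Type*} [NormedAddCommGroup E] [NormedSpace ℝ E]
  {M : Type u} [TopologicalSpace M] [ChartedSpace E M] {A : Type v} {G : Gpd M A}

theorem isChain_append {σ : unitInterval → M} {l₁ : List (A × (unitInterval → M))} {g : A} {τ : unitInterval → M}
    {l₂ : List (A × (unitInterval → M))} : IsChain E G σ (l₁ ++ (g, τ) :: l₂) ↔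
      IsChain E G σ l₁ ∧ G.src g = endOf σ l₁ ∧ G.tgt g = τ 0 ∧ IsChain E G τ l₂ := by
  induction l₁ generalizing σ with
  | nil => rfl
  | cons e l ih =>
    simp only [List.cons_append, IsChain, endOf, ih]
    tauto

theorem IsChain.head {σ : unitInterval → M} {l : List (A × (unitInterval → M))} (h : IsChain E G σ l) :
    PiecewiseSmooth E σ := by
  cases l with
  | nil => exact h
  | cons e l => exact h.1

theorem IsChain.mem {σ : unitInterval → M} {l : List (A × (unitInterval → M))} (h : IsChain E G σ l) :
    ∀ e ∈ l, PiecewiseSmooth E e.2 := by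
  induction l generalizing σ with
  | nil => simp
  | cons e l ih =>
    intro e' he'
    rcases List.mem_cons.1 he' with rfl | he'
    · exact h.2.2.2.head
    · exact ih h.2.2.2 e' he'

theorem isChain_revAux {σ : unitInterval → M} {l : List (A × (unitInterval → M))} (h : IsChain E G σ l) :
    IsChain E G (revAux G σ l).head (revAux G σ l).tail := by
  induction l generalizing σ with
  | nil => exact PiecewiseSmooth.symm h
  | cons e l ih =>
    obtain ⟨h1, h2, h3, h4⟩ := h
    refine isChain_append.2 ⟨ih h4, ?_, ?_, h1.symm⟩
    · exact (G.src_inv _).trans (h3.trans (endOf_revAux G e.2 l).symm)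
    · rw [G.tgt_inv, h2]; simp

theorem IsGPath.comp {x y z : M} {p q : RawGPath M A} (hp : IsGPath E G x y p)
    (hq : IsGPath E G y z q) : IsGPath E G x z (p.comp G q) :=
  ⟨isChain_append.2 ⟨hp.1, G.src_one _, by rw [G.tgt_one, hp.2.2, hq.2.1], hq.1⟩, hp.2.1,
    by rw [RawGPath.comp, endOf_append, hq.2.2]⟩

/-- The concatenation of `G`-paths. -/
def GPath.comp {x y z : M} (p : GPath E G x y) (q : GPath E G y z) : GPath E G x z :=
  ⟨p.1.comp G q.1, p.2.comp q.2⟩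

variable (E G) in
/-- The constant `G`-path, of order zero. -/
def GPath.const (x : M) : GPath E G x x :=
  ⟨⟨fun _ => x, []⟩, PiecewiseSmooth.const x, rfl, rfl⟩

/-- The reversed `G`-path. -/
def GPath.rev {x y : M} (p : GPath E G x y) : GPath E G y x :=
  ⟨revAux G p.1.head p.1.tail, isChain_revAux p.2.1, by rw [head_revAux, p.2.2.2],
    by rw [endOf_revAux, p.2.2.1]⟩

variable [TopologicalSpace A]

/-- The class of a `G`-path. -/
def GPath.cls {x y : M} (p : GPath E G x y) : HClass E G x y := Quot.mk _ p

/-- The family which is constant along a list. -/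
def constList {M : Type u} {A : Type v} (l : List (A × (unitInterval → M))) :
    List ((unitInterval → A) × (unitInterval → unitInterval → M)) :=
  l.map fun e => (fun _ => e.1, fun _ => e.2)

@[simp] theorem constList_map {M : Type u} {A : Type v} (l : List (A × (unitInterval → M))) (τ : unitInterval) :
    (constList l).map (fun e => (e.1 τ, e.2 τ)) = l := by
  simp [constList, Function.comp_def]

theorem continuous_constList {l : List (A × (unitInterval → M))} (h : ∀ e ∈ l, PiecewiseSmooth E e.2) :
    ∀ e ∈ constList l, Continuous e.1 ∧ Continuous (uncurry e.2) := by
  intro e he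
  obtain ⟨e', he', rfl⟩ := List.mem_map.1 he
  exact ⟨continuous_const, (h e' he').1.comp continuous_snd⟩

theorem RawStep.comp_right {x y z : M} {p p' : RawGPath M A} (hp : IsGPath E G x y p)
    (hp' : IsGPath E G x y p') (h : RawStep E G x y p p') {q : RawGPath M A}
    (hq : IsGPath E G y z q) : RawStep E G x z (p.comp G q) (p'.comp G q) := by
  have e1 := hp.2.2
  have e2 := hp'.2.2
  cases h with
  | mul σ l₁ g c h τ l₂ hc hgh =>
    simp only [RawGPath.comp] at e1 e2 ⊢
    rw [e1, e2]
    simp only [List.append_assoc, List.cons_append]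
    exact RawStep.mul _ _ _ _ _ _ _ hc hgh
  | concat_head σ τ l =>
    simp only [RawGPath.comp] at e1 e2 ⊢
    rw [e1, e2]
    exact RawStep.concat_head _ _ _
  | concat_tail σ l₁ g α β l₂ =>
    simp only [RawGPath.comp] at e1 e2 ⊢
    rw [e1, e2]
    simp only [List.append_assoc, List.cons_append]
    exact RawStep.concat_tail _ _ _ _ _ _
  | deform _ _ h =>
    obtain ⟨D₀, T, h1, h2, h3, rfl, rfl⟩ := h
    have e : ∀ τ, familyAt D₀ (T ++ constList ((G.one y, q.head) :: q.tail)) τ =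
        (familyAt D₀ T τ).comp G q := by
      intro τ
      have := (h3 τ).2.2
      simp only [RawGPath.comp]
      rw [this]
      simp [familyAt, -constList_map, constList, Function.comp_def]
    refine RawStep.deform _ _ ⟨D₀, T ++ constList ((G.one y, q.head) :: q.tail), h1, ?_, ?_,
      e 0, e 1⟩
    · intro a ha
      rcases List.mem_append.1 ha with ha | ha
      · exact h2 a ha
      · refine continuous_constList (E := E) ?_ a ha
        intro b hb
        rcases List.mem_cons.1 hb with rfl | hb
        · exact hq.1.head
        · exact hq.1.mem b hb
    · intro τ
      rw [e]
      exact (h3 τ).comp hq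

theorem RawStep.comp_left {x y z : M} {p : RawGPath M A} (hp : IsGPath E G x y p)
    {q q' : RawGPath M A} (h : RawStep E G y z q q') :
    RawStep E G x z (p.comp G q) (p.comp G q') := by
  cases h with
  | mul σ l₁ g c h τ l₂ hc hgh =>
    have := RawStep.mul (E := E) (G := G) (x := x) (y := z) p.head
      (p.tail ++ (G.one (endOf p.head p.tail), σ) :: l₁) g c h τ l₂ hc hgh
    simpa [RawGPath.comp] using this
  | concat_head σ τ l => exact RawStep.concat_tail _ _ _ _ _ _
  | concat_tail σ l₁ g α β l₂ =>
    have := RawStep.concat_tail (E := E) (G := G) (x := x) (y := z) p.head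
      (p.tail ++ (G.one (endOf p.head p.tail), σ) :: l₁) g α β l₂
    simpa [RawGPath.comp] using this
  | deform _ _ h =>
    obtain ⟨D₀, T, h1, h2, h3, rfl, rfl⟩ := h
    have e : ∀ τ, familyAt (fun _ => p.head)
        (constList p.tail ++ (fun _ => G.one (endOf p.head p.tail), D₀) :: T) τ =
        p.comp G (familyAt D₀ T τ) := by
      intro τ
      simp [familyAt, RawGPath.comp]
    refine RawStep.deform _ _ ⟨fun _ => p.head, _, hp.1.head.1.comp continuous_snd, ?_, ?_,
      e 0, e 1⟩
    · intro a ha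
      rcases List.mem_append.1 ha with ha | ha
      · exact continuous_constList hp.1.mem a ha
      · rcases List.mem_cons.1 ha with rfl | ha
        · exact ⟨continuous_const, h1⟩
        · exact h2 a ha
    · intro τ
      rw [e]
      exact hp.comp (h3 τ)

/-- The multiplication of the fundamental groupoid, induced by concatenation. -/
def HClass.comp {x y z : M} (a : HClass E G x y) (b : HClass E G y z) : HClass E G x z :=
  Quot.map₂ GPath.comp (fun p _ _ h => RawStep.comp_left p.2 h)
    (fun p p' q h => RawStep.comp_right p.2 p'.2 h q.2) a b

theorem HClass.comp_assoc {x y z w : M} (a : HClass E G x y) (b : HClass E G y z)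
    (c : HClass E G z w) : (a.comp b).comp c = a.comp (b.comp c) := by
  induction a using Quot.ind with | _ p
  induction b using Quot.ind with | _ q
  induction c using Quot.ind with | _ r
  refine congrArg (Quot.mk _) (Subtype.ext ?_)
  simp [GPath.comp, RawGPath.comp]

theorem cls_deform_head {x y : M} (h : unitInterval → unitInterval → M) (hh : Continuous (uncurry h))
    (hps : ∀ τ, PiecewiseSmooth E (h τ)) (h0 : ∀ τ, h τ 0 = h 0 0) (h1 : ∀ τ, h τ 1 = h 0 1)
    (l : List (A × (unitInterval → M))) (hp : IsGPath E G x y ⟨h 0, l⟩) :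
    ∃ hq : IsGPath E G x y ⟨h 1, l⟩, GPath.cls ⟨_, hp⟩ = GPath.cls ⟨_, hq⟩ := by
  have hv : ∀ τ, IsGPath E G x y ⟨h τ, l⟩ := by
    intro τ
    obtain ⟨p1, p2, p3⟩ := hp
    simp only at p1 p2 p3
    refine ⟨?_, (h0 τ).trans p2, ?_⟩
    · cases l with
      | nil => exact hps τ
      | cons e l => exact ⟨hps τ, p1.2.1.trans (h1 τ).symm, p1.2.2⟩
    · cases l with
      | nil => exact (h1 τ).trans p3
      | cons e l => exact p3
  refine ⟨hv 1, Quot.sound (RawStep.deform _ _ ⟨h, constList l, hh, ?_, ?_, ?_, ?_⟩)⟩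
  · exact continuous_constList hp.1.mem
  · intro τ
    simpa [familyAt] using hv τ
  · simp [familyAt]
  · simp [familyAt]

theorem cls_deform_tail {x y : M} (h : unitInterval → unitInterval → M) (hh : Continuous (uncurry h))
    (hps : ∀ τ, PiecewiseSmooth E (h τ)) (h0 : ∀ τ, h τ 0 = h 0 0) (h1 : ∀ τ, h τ 1 = h 0 1)
    (σ : unitInterval → M) (l₁ : List (A × (unitInterval → M))) (g : A) (l : List (A × (unitInterval → M)))
    (hp : IsGPath E G x y ⟨σ, l₁ ++ (g, h 0) :: l⟩) :
    ∃ hq : IsGPath E G x y ⟨σ, l₁ ++ (g, h 1) :: l⟩, GPath.cls ⟨_, hp⟩ = GPath.cls ⟨_, hq⟩ := by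
  have hv : ∀ τ, IsGPath E G x y ⟨σ, l₁ ++ (g, h τ) :: l⟩ := by
    intro τ
    obtain ⟨p1, p2, p3⟩ := hp
    simp only at p1 p2 p3
    rw [endOf_append] at p3
    obtain ⟨q1, q2, q3, q4⟩ := isChain_append.1 p1
    refine ⟨isChain_append.2 ⟨q1, q2, q3.trans (h0 τ).symm, ?_⟩, p2, ?_⟩
    · cases l with
      | nil => exact hps τ
      | cons e l => exact ⟨hps τ, q4.2.1.trans (h1 τ).symm, q4.2.2⟩
    · simp only [endOf_append]
      cases l with
      | nil => exact (h1 τ).trans p3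
      | cons e l => exact p3
  obtain ⟨q1, q2, q3, q4⟩ := isChain_append.1 hp.1
  refine ⟨hv 1, Quot.sound (RawStep.deform _ _ ⟨fun _ => σ,
    constList l₁ ++ (fun _ => g, h) :: constList l, q1.head.1.comp continuous_snd, ?_, ?_, ?_, ?_⟩)⟩
  · intro a ha
    rcases List.mem_append.1 ha with ha | ha
    · exact continuous_constList q1.mem a ha
    · rcases List.mem_cons.1 ha with rfl | ha
      · exact ⟨continuous_const, hh⟩
      · exact continuous_constList q4.mem a ha
  · intro τ
    simpa [familyAt] using hv τ
  · simp [familyAt]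
  · simp [familyAt]

theorem HClass.const_comp {x y : M} (a : HClass E G x y) :
    (GPath.const E G x).cls.comp a = a := by
  induction a using Quot.ind with | _ p
  obtain ⟨⟨σ, l⟩, hp⟩ := p
  obtain ⟨p1, rfl, p3⟩ := hp
  simp only at p1 p3
  have hσ := p1.head
  have hp : IsGPath E G (σ 0) y ⟨fun t => σ (delay 1 t), l⟩ := by
    have : (fun t => σ (delay 1 t)) = σ := by
      funext t
      congr 1
      ext
      simp [delay]
    rw [this]
    exact ⟨p1, rfl, p3⟩
  have hone : ∀ τ, delay τ 1 = 1 := fun τ => by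
    ext; norm_num [delay]
  have hzero : ∀ τ, delay τ 0 = 0 := fun τ => by
    ext; norm_num [delay]
  obtain ⟨hq, e⟩ := cls_deform_head (fun τ t => σ (delay (unitInterval.symm τ) t))
    (hσ.1.comp (continuous_delay.comp ((unitInterval.continuous_symm.comp continuous_fst).prodMk
      continuous_snd)))
    (fun τ => hσ.delay _) (fun τ => by simp only [hzero]) (fun τ => by simp only [hone]) l
    (by simpa using hp)
  have hq' : IsGPath E G (σ 0) y ⟨concat (fun _ => σ 0) σ, l⟩ := by
    rw [concat_const]; simpa using hq
  have s1 : (GPath.const E G (σ 0)).cls.comp (GPath.cls ⟨⟨σ, l⟩, p1, rfl, p3⟩) =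
      GPath.cls ⟨_, hq'⟩ := Quot.sound (RawStep.concat_head (fun _ => σ 0) σ l)
  refine s1.trans ?_
  have s2 : GPath.cls ⟨_, hq'⟩ = GPath.cls ⟨_, hq⟩ :=
    congrArg GPath.cls (Subtype.ext (by simp [concat_const]))
  rw [s2, ← e]
  refine congrArg (Quot.mk _) (Subtype.ext ?_)
  simp only [RawGPath.mk.injEq, and_true]
  funext t
  congr 1
  ext
  simp [delay]

theorem cls_rev_comp_aux (σ : unitInterval → M) (l : List (A × (unitInterval → M))) (hc : IsChain E G σ l) (y : M)
    (hy : endOf σ l = y)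
    (hp : IsGPath E G y y ((revAux G σ l).comp G ⟨σ, l⟩)) :
    GPath.cls ⟨_, hp⟩ = (GPath.const E G y).cls := by
  have hone : ∀ τ, tent τ 1 = 1 := fun τ => by
    ext; norm_num [tent]
  have hzero : ∀ τ, tent τ 0 = 1 := fun τ => by
    ext; norm_num [tent]
  have hend : ∀ t, tent 1 t = 1 := fun t => by
    ext; simp [tent]
  induction l generalizing σ with
  | nil =>
    have hσ := hc.head
    have hy' : σ 1 = y := hy
    have hq : IsGPath E G y y ⟨concat (fun t => σ (unitInterval.symm t)) σ, []⟩ := by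
      rw [concat_symm_self]
      exact ⟨hσ.tent 0, by simp [hzero, hy'], by simp [endOf, hone, hy']⟩
    have s1 : GPath.cls ⟨_, hp⟩ = GPath.cls ⟨_, hq⟩ := Quot.sound (by
      have := RawStep.concat_head (E := E) (G := G) (x := y) (y := y)
        (fun t => σ (unitInterval.symm t)) σ []
      simpa [revAux, RawGPath.comp, endOf] using this)
    rw [s1]
    obtain ⟨hr, e⟩ := cls_deform_head (fun τ t => σ (tent τ t))
      (hσ.1.comp continuous_tent)
      (fun τ => hσ.tent τ) (fun τ => by simp only [hzero]) (fun τ => by simp only [hone]) []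
      (by simpa only [concat_symm_self] using hq)
    have s2 : GPath.cls ⟨_, hq⟩ = GPath.cls ⟨_, _⟩ :=
      (congrArg GPath.cls (Subtype.ext (by simp [concat_symm_self]))).trans e
    rw [s2]
    refine congrArg (Quot.mk _) (Subtype.ext ?_)
    simp [GPath.const, hend, hy']
  | cons a l ih =>
    obtain ⟨g, τ⟩ := a
    obtain ⟨hσ, c2, c3, c4⟩ := hc
    have hy' : endOf τ l = y := hy
    set r := revAux G τ l with hr
    have hrc : IsChain E G r.head r.tail := isChain_revAux c4
    have hre : endOf r.head r.tail = τ 0 := endOf_revAux G τ l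
    have hr0 : r.head 0 = y := (head_revAux G τ l).trans hy'
    have hpe : (revAux G σ ((g, τ) :: l)).comp G ⟨σ, (g, τ) :: l⟩ =
        ⟨r.head, r.tail ++ (G.inv g, fun t => σ (unitInterval.symm t)) ::
          (G.one (σ 0), σ) :: (g, τ) :: l⟩ := by
      simp [RawGPath.comp, revAux, ← hr, endOf]
    have hbase : ∀ κ : unitInterval → M, PiecewiseSmooth E κ → κ 0 = σ 1 → κ 1 = σ 1 →
        IsGPath E G y y ⟨r.head, r.tail ++ (G.inv g, κ) :: (g, τ) :: l⟩ := by
      intro κ k1 k2 k3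
      refine ⟨isChain_append.2 ⟨hrc, ?_, ?_, k1, ?_, c3, c4⟩, hr0, ?_⟩
      · rw [G.src_inv, hre, c3]
      · rw [G.tgt_inv, c2, k2]
      · rw [c2, k3]
      · simpa [endOf] using hy'
    have hq : IsGPath E G y y ⟨r.head, r.tail ++
        (G.inv g, concat (fun t => σ (unitInterval.symm t)) σ) :: (g, τ) :: l⟩ := by
      refine hbase _ ?_ ?_ ?_
      · rw [concat_symm_self]; exact hσ.tent 0
      · simp [concat_symm_self, hzero]
      · simp [concat_symm_self, hone]
    have s1 : GPath.cls ⟨_, hp⟩ = GPath.cls ⟨_, hq⟩ := Quot.sound (by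
      have := RawStep.concat_tail (E := E) (G := G) (x := y) (y := y) r.head r.tail (G.inv g)
        (fun t => σ (unitInterval.symm t)) σ ((g, τ) :: l)
      simp only [unitInterval.symm_one] at this
      simp only [hpe]
      exact this)
    rw [s1]
    obtain ⟨hd, e⟩ := cls_deform_tail (fun τ t => σ (tent τ t))
      (hσ.1.comp continuous_tent)
      (fun τ => hσ.tent τ) (fun τ => by simp only [hzero]) (fun τ => by simp only [hone])
      r.head r.tail (G.inv g) ((g, τ) :: l)
      (by simpa only [concat_symm_self] using hq)
    have s2 : GPath.cls ⟨_, hq⟩ = GPath.cls ⟨_, _⟩ :=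
      (congrArg GPath.cls (Subtype.ext (by simp [concat_symm_self]))).trans e
    rw [s2]
    have hcomp : r.comp G ⟨τ, l⟩ = ⟨r.head, r.tail ++ (G.mul g (G.inv g), τ) :: l⟩ := by
      simp [RawGPath.comp, hre, G.mul_inv, c3]
    have hf : IsGPath E G y y (r.comp G ⟨τ, l⟩) :=
      IsGPath.comp (y := τ 0) ⟨hrc, hr0, hre⟩ ⟨c4, rfl, hy'⟩
    rw [← ih τ c4 hy' hf]
    refine Quot.sound ?_
    change RawStep E G y y _ (r.comp G ⟨τ, l⟩)
    rw [hcomp]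
    exact RawStep.mul _ _ _ _ _ _ _ (fun t => by simp [hend]) (G.tgt_inv g).symm

theorem cls_rev_comp {x y : M} (p : GPath E G x y) :
    (p.rev.comp p).cls = (GPath.const E G y).cls :=
  cls_rev_comp_aux p.1.head p.1.tail p.2.1 y p.2.2.2 (p.rev.comp p).2

/-- The fundamental group, with the multiplication `[p] * [q]` (first `p`, then `q`) induced by
concatenation. The class of the constant path is the unit; the inverse is the class of the
reversed path. -/
noncomputable instance (x : M) : Group (FundGroup E G x) :=
  letI : Mul (FundGroup E G x) := ⟨fun a b => HClass.comp a b⟩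
  letI : One (FundGroup E G x) := ⟨(GPath.const E G x).cls⟩
  letI : Inv (FundGroup E G x) := ⟨fun a => (GPath.rev (Quot.out a)).cls⟩
  Group.ofLeftAxioms HClass.comp_assoc HClass.const_comp (fun a => by
    have h := cls_rev_comp (Quot.out a)
    have e : (Quot.out a).cls = a := Quot.out_eq a
    have h' : HClass.comp (GPath.rev (Quot.out a)).cls (Quot.out a).cls =
        (GPath.const E G x).cls := h
    rw [e] at h'
    exact h')

/-- The class of a `G`-loop in the fundamental group. -/
def FundGroup.mk {x : M} (p : GPath E G x x) : FundGroup E G x := p.cls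

theorem FundGroup.mk_mul {x : M} (p q : GPath E G x x) :
    FundGroup.mk p * FundGroup.mk q = FundGroup.mk (p.comp q) := rfl

theorem FundGroup.one_def (x : M) : (1 : FundGroup E G x) = FundGroup.mk (GPath.const E G x) := rfl

theorem FundGroup.inv_mk {x : M} (p : GPath E G x x) :
    (FundGroup.mk p)⁻¹ = FundGroup.mk p.rev :=
  inv_eq_of_mul_eq_one_left (cls_rev_comp p)

end GroupStructure

/-! ### Morphisms and the induced maps on fundamental groups -/

/-- A morphism of groupoids which is smooth on objects and continuous on arrows. -/
structure Hom (E : Type*) [NormedAddCommGroup E] [NormedSpace ℝ E]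
    {M : Type*} [TopologicalSpace M] [ChartedSpace E M] {A : Type*} [TopologicalSpace A]
    {N : Type*} [TopologicalSpace N] [ChartedSpace E N] {B : Type*} [TopologicalSpace B]
    (G : Gpd M A) (K : Gpd N B) where
  obj : M → N
  arr : A → B
  src_arr : ∀ g, K.src (arr g) = obj (G.src g)
  tgt_arr : ∀ g, K.tgt (arr g) = obj (G.tgt g)
  arr_one : ∀ x, arr (G.one x) = K.one (obj x)
  arr_mul : ∀ g h, G.src g = G.tgt h → arr (G.mul g h) = K.mul (arr g) (arr h)
  smooth_obj : ContMDiff 𝓘(ℝ, E) 𝓘(ℝ, E) ∞ obj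
  continuous_arr : Continuous arr

namespace Hom

variable {E : Type*} [NormedAddCommGroup E] [NormedSpace ℝ E]
  {M : Type*} [TopologicalSpace M] [ChartedSpace E M] {A : Type*} [TopologicalSpace A]
  {N : Type*} [TopologicalSpace N] [ChartedSpace E N] {B : Type*} [TopologicalSpace B]
  {G : Gpd M A} {K : Gpd N B} (Φ : Hom E G K)

/-- The image of a list of arrows and paths. -/
def mapList (l : List (A × (unitInterval → M))) : List (B × (unitInterval → N)) :=
  l.map fun e => (Φ.arr e.1, fun t => Φ.obj (e.2 t))

/-- The image `φ₀(σₙ) φ₁(gₙ) ⋯ φ₁(g₁) φ₀(σ₀)`. -/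
def mapRaw (p : RawGPath M A) : RawGPath N B :=
  ⟨fun t => Φ.obj (p.head t), Φ.mapList p.tail⟩

theorem endOf_map (σ : unitInterval → M) (l : List (A × (unitInterval → M))) :
    endOf (fun t => Φ.obj (σ t)) (Φ.mapList l) = Φ.obj (endOf σ l) := by
  induction l generalizing σ with
  | nil => rfl
  | cons e l ih => exact ih e.2

theorem isChain_map {σ : unitInterval → M} {l : List (A × (unitInterval → M))} (h : IsChain E G σ l) :
    IsChain E K (fun t => Φ.obj (σ t)) (Φ.mapList l) := by
  induction l generalizing σ with
  | nil => exact PiecewiseSmooth.map h Φ.smooth_obj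
  | cons e l ih =>
    obtain ⟨h1, h2, h3, h4⟩ := h
    exact ⟨h1.map Φ.smooth_obj, by rw [Φ.src_arr, h2], by rw [Φ.tgt_arr, h3], ih h4⟩

theorem isGPath_map {x y : M} {p : RawGPath M A} (hp : IsGPath E G x y p) :
    IsGPath E K (Φ.obj x) (Φ.obj y) (Φ.mapRaw p) :=
  ⟨Φ.isChain_map hp.1, congrArg Φ.obj hp.2.1, (Φ.endOf_map _ _).trans (congrArg Φ.obj hp.2.2)⟩

theorem rawStep_map {x y : M} {p q : RawGPath M A} (h : RawStep E G x y p q) :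
    RawStep E K (Φ.obj x) (Φ.obj y) (Φ.mapRaw p) (Φ.mapRaw q) := by
  cases h with
  | mul σ l₁ g c h τ l₂ hc hgh =>
    simp only [mapRaw, mapList, List.map_append, List.map_cons]
    rw [Φ.arr_mul _ _ hgh]
    exact RawStep.mul _ _ _ _ _ _ _ (fun t => by rw [hc t]) (by rw [Φ.src_arr, Φ.tgt_arr, hgh])
  | concat_head σ τ l =>
    simp only [mapRaw, mapList, List.map_cons, map_concat]
    rw [Φ.arr_one]
    exact RawStep.concat_head _ _ _
  | concat_tail σ l₁ g α β l₂ =>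
    simp only [mapRaw, mapList, List.map_append, List.map_cons, map_concat]
    rw [Φ.arr_one]
    exact RawStep.concat_tail _ _ _ _ _ _
  | deform _ _ h =>
    obtain ⟨D₀, T, h1, h2, h3, rfl, rfl⟩ := h
    have e : ∀ τ, familyAt (fun τ t => Φ.obj (D₀ τ t))
        (T.map fun e => (fun τ => Φ.arr (e.1 τ), fun τ t => Φ.obj (e.2 τ t))) τ =
        Φ.mapRaw (familyAt D₀ T τ) := by
      intro τ
      simp [familyAt, mapRaw, mapList]
    refine RawStep.deform _ _ ⟨fun τ t => Φ.obj (D₀ τ t), _, Φ.smooth_obj.continuous.comp h1, ?_,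
      ?_, e 0, e 1⟩
    · intro a ha
      obtain ⟨b, hb, rfl⟩ := List.mem_map.1 ha
      exact ⟨Φ.continuous_arr.comp (h2 b hb).1, Φ.smooth_obj.continuous.comp (h2 b hb).2⟩
    · intro τ
      rw [e]
      exact Φ.isGPath_map (h3 τ)

/-- The image of a `G`-path from `x` to `y`; the images of `x` and `y` are given by equations. -/
def mapGPath {x y : M} {x' y' : N} (hx : Φ.obj x = x') (hy : Φ.obj y = y') (p : GPath E G x y) :
    GPath E K x' y' :=
  ⟨Φ.mapRaw p.1, by subst hx hy; exact Φ.isGPath_map p.2⟩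

/-- The homomorphism of fundamental groups induced by `Φ`, namely `[p] ↦ [Φ(p)]`, where the image
`x'` of the base point `x` is given by an equation. -/
noncomputable def fundMap {x : M} {x' : N} (hx : Φ.obj x = x') :
    FundGroup E G x →* FundGroup E K x' :=
  MonoidHom.mk' (Quot.map (Φ.mapGPath hx hx) fun _ _ h => by
    subst hx; exact Φ.rawStep_map h) (by
    intro a b
    induction a using Quot.ind with | _ p
    induction b using Quot.ind with | _ q
    refine congrArg (Quot.mk _) (Subtype.ext ?_)
    simp only [mapGPath, GPath.comp, RawGPath.comp, mapRaw, mapList, List.map_append,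
      List.map_cons, Φ.arr_one]
    rw [← Φ.endOf_map]
    rfl)

theorem fundMap_mk {x : M} {x' : N} (hx : Φ.obj x = x') (p : GPath E G x x) :
    Φ.fundMap hx (FundGroup.mk p) = FundGroup.mk (Φ.mapGPath hx hx p) := rfl

end Hom

/-! ### Covering spaces over a Lie groupoid -/

section Covering

variable {E : Type*} [NormedAddCommGroup E] [NormedSpace ℝ E]
  {E' : Type*} [NormedAddCommGroup E'] [NormedSpace ℝ E']
  {M : Type u} [TopologicalSpace M] [ChartedSpace E M]
  {A : Type v} [TopologicalSpace A] [ChartedSpace E' A]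

/-- A covering space `F` over the Lie groupoid `G`: a smooth covering projection `proj : F → M`
with a smooth right action of `G` along `proj`. The product `act e g` is meaningful when
`proj e = tgt g`: the other values of `act` are irrelevant. -/
structure CoveringSpace (G : LieGroupoid E E' M A) (F : Type w) [TopologicalSpace F]
    [ChartedSpace E F] where
  proj : F → M
  isCoveringMap : IsCoveringMap proj
  surjective : Surjective proj
  isLocalDiffeomorph : IsLocalDiffeomorph 𝓘(ℝ, E) 𝓘(ℝ, E) ∞ proj
  act : F → A → F
  proj_act : ∀ e g, proj e = G.tgt g → proj (act e g) = G.src g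
  act_one : ∀ e, act e (G.one (proj e)) = e
  act_mul : ∀ e g h, proj e = G.tgt g → G.src g = G.tgt h →
    act (act e g) h = act e (G.mul g h)
  smooth_act : ContMDiffOn (𝓘(ℝ, E).prod 𝓘(ℝ, E')) 𝓘(ℝ, E) ∞
    (fun p : F × A => act p.1 p.2) {p : F × A | proj p.1 = G.tgt p.2}

namespace CoveringSpace

variable {G : LieGroupoid E E' M A} {F : Type w} [TopologicalSpace F] [ChartedSpace E F]

/-- The arrows of the action groupoid: the fibre product `F ×_M A`, with the topology of a
subspace of `F × A`. -/
abbrev Arrows (C : CoveringSpace G F) : Type (max w v) := {p : F × A // C.proj p.1 = G.tgt p.2}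

open Classical in
/-- The action groupoid `F ⋊ G` over `F`, in which `(e, g)` is an arrow from `e g` to `e`. -/
noncomputable def actionGroupoid (C : CoveringSpace G F) : Gpd F C.Arrows where
  src a := C.act a.1.1 a.1.2
  tgt a := a.1.1
  one e := ⟨(e, G.one (C.proj e)), (G.tgt_one _).symm⟩
  mul a b := if h : C.act a.1.1 a.1.2 = b.1.1 then
      ⟨(a.1.1, G.mul a.1.2 b.1.2), by
        rw [G.tgt_mul]
        · exact a.2
        · rw [← b.2, ← h, C.proj_act _ _ a.2]⟩
    else a
  inv a := ⟨(C.act a.1.1 a.1.2, G.inv a.1.2), by rw [C.proj_act _ _ a.2, G.tgt_inv]⟩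
  src_one e := C.act_one e
  tgt_one e := rfl
  src_mul a b h := by
    have hc : G.src a.1.2 = G.tgt b.1.2 := by rw [← b.2, ← h, C.proj_act _ _ a.2]
    rw [dif_pos h]
    simp only
    rw [← C.act_mul _ _ _ a.2 hc, h]
  tgt_mul a b h := by rw [dif_pos h]
  mul_assoc a b c h h' := by
    have hab : G.src a.1.2 = G.tgt b.1.2 := by rw [← b.2, ← h, C.proj_act _ _ a.2]
    have hbc : G.src b.1.2 = G.tgt c.1.2 := by rw [← c.2, ← h', C.proj_act _ _ b.2]
    have h1 : C.act a.1.1 (G.mul a.1.2 b.1.2) = c.1.1 := by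
      rw [← C.act_mul _ _ _ a.2 hab, h, h']
    simp only [dif_pos h, dif_pos h', dif_pos h1]
    exact Subtype.ext (Prod.ext rfl (G.mul_assoc _ _ _ hab hbc))
  one_mul a := by
    rw [dif_pos (C.act_one _)]
    exact Subtype.ext (Prod.ext rfl (by simp only; rw [a.2, G.one_mul]))
  mul_one a := by
    rw [dif_pos rfl]
    exact Subtype.ext (Prod.ext rfl (by simp only; rw [C.proj_act _ _ a.2, G.mul_one]))
  src_inv a := by
    simp only
    rw [C.act_mul _ _ _ a.2 (G.tgt_inv _).symm, G.mul_inv, ← a.2, C.act_one]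
  tgt_inv a := rfl
  inv_mul a := by
    have h : C.act (C.act a.1.1 a.1.2) (G.inv a.1.2) = a.1.1 := by
      rw [C.act_mul _ _ _ a.2 (G.tgt_inv _).symm, G.mul_inv, ← a.2, C.act_one]
    rw [dif_pos h]
    exact Subtype.ext (Prod.ext rfl (by simp only; rw [G.inv_mul, C.proj_act _ _ a.2]))
  mul_inv a := by
    rw [dif_pos rfl]
    exact Subtype.ext (Prod.ext rfl (by simp only; rw [G.mul_inv, a.2]))

/-- The morphism `F ⋊ G → G`, `(e, g) ↦ g`, over the covering projection. -/
noncomputable def toHom (C : CoveringSpace G F) : Hom E C.actionGroupoid G.toGpd where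
  obj := C.proj
  arr a := a.1.2
  src_arr a := (C.proj_act _ _ a.2).symm
  tgt_arr a := a.2.symm
  arr_one _ := rfl
  arr_mul a b h := by
    have h' : C.act a.1.1 a.1.2 = b.1.1 := h
    simp only [actionGroupoid, dif_pos h']
  smooth_obj := C.isLocalDiffeomorph.contMDiff
  continuous_arr := continuous_snd.comp continuous_subtype_val

end CoveringSpace

end Covering

end LieGpd

namespace LieGpd

/-! ### The fundamental groupoid -/

section FundamentalGroupoid

variable {E : Type*} [NormedAddCommGroup E] [NormedSpace ℝ E]
  {M : Type u} [TopologicalSpace M] [ChartedSpace E M] {A : Type v} [TopologicalSpace A]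
  {G : Gpd M A} {x y z : M}

/-! The construction follows the classical covering theory. The points over `x` are the homotopy
classes of `G`-paths from `x₀` to `x` modulo left multiplication by `H`. All computations take place
in the fundamental groupoid, where every class factors into classes of paths in `M` and classes of
single arrows (`cls_cons`); composing on the right moves the points of the covering (`Cover.ext`).

Topology: preimages of balls under charts form a basis of simple open sets `U`, inside which any two
points are joined by exactly one class (`IsSimple.exists_inside`, `IsSimple.inside_unique`). Hence
the set of points reached from a given one inside `U` projects bijectively onto `U`, and two such
sheets are equal or disjoint; this makes the projection a covering map (`Cover.isCoveringMap_proj`).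
Charts are pulled back from `M`, so a map into the covering is smooth when it is continuous and its
projection is smooth.

Action: an arrow `g` acts by transport along its inverse. After projection this is the source map,
so only continuity is at stake. An arrow near `g` is joined to `g` by a short path of arrows, and
the resulting deformation shows that the two transports differ by short paths at both ends
(`exists_inside_comp_arrCls`).

Fundamental group: the action groupoid has an arrow from `f` to `e` over `g` exactly when transport
along `g` takes `f` to `e`. So `G`-paths lift (`Cover.exists_lift_gpath`), and any lift from `e`
ends at the transport of `e` along the class below (`Cover.endOf_eq_ext`). A class at `x₀` is
therefore the image of a loop at the base point exactly when it fixes the base point, that is, when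
it lies in `H`. Lifting representatives from the base point also gives connectedness.

Second countability: arrows lead from one sheet to only countably many others. The sheets reached in
finitely many steps fill a clopen invariant set, which is everything by connectedness. -/

variable (E G) in
/-- The unit of the fundamental groupoid at `x`. -/
def HClass.one (x : M) : HClass E G x x := (GPath.const E G x).cls

theorem HClass.one_comp (a : HClass E G x y) : (HClass.one E G x).comp a = a :=
  HClass.const_comp a

theorem HClass.exists_left_inv (a : HClass E G x y) :
    ∃ b : HClass E G y x, b.comp a = HClass.one E G y := by
  induction a using Quot.ind with | _ p
  exact ⟨p.rev.cls, cls_rev_comp p⟩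

theorem HClass.exists_inv (a : HClass E G x y) :
    ∃ b : HClass E G y x, a.comp b = HClass.one E G x ∧ b.comp a = HClass.one E G y := by
  obtain ⟨b, hb⟩ := a.exists_left_inv
  obtain ⟨c, hc⟩ := b.exists_left_inv
  refine ⟨b, ?_, hb⟩
  -- As `c` is a left inverse of `b`: `ab = (cb)(ab) = c(ba)b = cb = 1`.
  rw [← HClass.one_comp (a.comp b), ← hc, HClass.comp_assoc, ← HClass.comp_assoc b, hb,
    HClass.one_comp]

/-- The inverse in the fundamental groupoid. -/
noncomputable def HClass.inv (a : HClass E G x y) : HClass E G y x := a.exists_inv.choose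

theorem HClass.comp_inv (a : HClass E G x y) : a.comp a.inv = HClass.one E G x :=
  a.exists_inv.choose_spec.1

theorem HClass.inv_comp (a : HClass E G x y) : a.inv.comp a = HClass.one E G y :=
  a.exists_inv.choose_spec.2

theorem HClass.comp_one (a : HClass E G x y) : a.comp (HClass.one E G y) = a := by
  rw [← a.inv_comp, ← HClass.comp_assoc, a.comp_inv, HClass.one_comp]

theorem HClass.comp_inv_comp (a : HClass E G x y) (b : HClass E G x z) :
    a.comp (a.inv.comp b) = b := by
  rw [← HClass.comp_assoc, a.comp_inv, HClass.one_comp]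

theorem HClass.inv_eq_of_comp_eq_one {a : HClass E G x y} {b : HClass E G y x}
    (h : a.comp b = HClass.one E G x) : a.inv = b := by
  rw [← a.inv.comp_one, ← h, ← HClass.comp_assoc, a.inv_comp, HClass.one_comp]

/-- The class of a path in `M`, as a `G`-path of order zero. -/
def pathCls (G : Gpd M A) (σ : unitInterval → M) (hσ : PiecewiseSmooth E σ) (h0 : σ 0 = x)
    (h1 : σ 1 = y) : HClass E G x y :=
  GPath.cls ⟨⟨σ, []⟩, hσ, h0, h1⟩

variable (E G) in
/-- The class of an arrow. -/
def arrCls (g : A) (h0 : G.src g = x) (h1 : G.tgt g = y) : HClass E G x y :=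
  GPath.cls ⟨⟨fun _ => x, [(g, fun _ => y)]⟩,
    ⟨PiecewiseSmooth.const x, h0, h1, PiecewiseSmooth.const y⟩, rfl, rfl⟩

theorem PiecewiseSmooth.concat {σ τ : unitInterval → M} (hσ : PiecewiseSmooth E σ)
    (hτ : PiecewiseSmooth E τ) (h : σ 1 = τ 0) : PiecewiseSmooth E (concat σ τ) := by
  obtain ⟨cσ, S, hS⟩ := hσ
  obtain ⟨cτ, T, hT⟩ := hτ
  have hleft : ∀ u : ℝ, 0 ≤ u → u ≤ 1 / 2 →
      Set.IccExtend (zero_le_one (α := ℝ)) (LieGpd.concat σ τ) u =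
        (Set.IccExtend (zero_le_one (α := ℝ)) σ ∘ fun u => 2 * u) u := by
    intro u h0 h1
    rw [Set.IccExtend_of_mem _ _ (⟨h0, by linarith⟩ : u ∈ Set.Icc (0 : ℝ) 1)]
    simp only [LieGpd.concat, comp_apply, if_pos h1]
  have hright : ∀ u : ℝ, 1 / 2 ≤ u → u ≤ 1 →
      Set.IccExtend (zero_le_one (α := ℝ)) (LieGpd.concat σ τ) u =
        (Set.IccExtend (zero_le_one (α := ℝ)) τ ∘ fun u => 2 * u - 1) u := by
    intro u h0 h1
    -- At `u = 1/2` the concatenation takes its left branch; the right formula still holds because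
    -- the paths match there. This gives smoothness on closed intervals starting at `1/2`.
    rcases h0.eq_or_lt with h0 | h0
    · rw [hleft u (by linarith) h0.ge]
      subst h0
      have e1 : (2 : ℝ) * (1 / 2) = 1 := by norm_num
      simp only [comp_apply, e1, sub_self, Set.IccExtend_left, Set.IccExtend_right]
      exact h
    · rw [Set.IccExtend_of_mem _ _ (⟨by linarith, h1⟩ : u ∈ Set.Icc (0 : ℝ) 1)]
      simp only [LieGpd.concat, comp_apply, if_neg (not_le.2 h0)]
  refine ⟨?_, ?_⟩
  · have e : LieGpd.concat σ τ = fun t : unitInterval => if (t : ℝ) ≤ 1 / 2 then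
        Set.IccExtend (zero_le_one (α := ℝ)) σ (2 * t) else
        Set.IccExtend (zero_le_one (α := ℝ)) τ (2 * t - 1) := rfl
    rw [e]
    refine Continuous.if_le (cσ.Icc_extend'.comp (by fun_prop))
      (cτ.Icc_extend'.comp (by fun_prop)) (by fun_prop) (by fun_prop) ?_
    intro t ht
    rw [ht]
    norm_num
    exact h
  classical
  -- The break points are the junction and the old ones pulled back along `u ↦ 2u` and `u ↦ 2u - 1`.
  refine ⟨{1 / 2} ∪ S.image (fun c => c / 2) ∪ T.image (fun c => (c + 1) / 2), ?_⟩
  intro a b ha hab hb hmiss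
  have hhalf : ¬ (a < 1 / 2 ∧ 1 / 2 < b) := hmiss (1 / 2) (by simp)
  by_cases hb2 : b ≤ 1 / 2
  · refine ContMDiffOn.congr (ContMDiffOn.comp (t := Set.Icc (2 * a) (2 * b))
      (hS _ _ (by linarith) (by linarith) (by linarith) ?_)
      (f := fun u : ℝ => 2 * u) (ContDiffOn.contMDiffOn (by fun_prop)) ?_)
      fun u hu => hleft u (ha.trans hu.1) (hu.2.trans hb2)
    · intro c hc hcI
      refine hmiss (c / 2) ?_ ⟨by linarith [hcI.1], by linarith [hcI.2]⟩
      simp only [Finset.mem_union, Finset.mem_image]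
      exact .inl (.inr ⟨c, hc, rfl⟩)
    · intro u hu
      exact ⟨by linarith [hu.1], by linarith [hu.2]⟩
  · have ha2 : 1 / 2 ≤ a := by
      by_contra h
      exact hhalf ⟨not_le.1 h, not_le.1 hb2⟩
    refine ContMDiffOn.congr (ContMDiffOn.comp (t := Set.Icc (2 * a - 1) (2 * b - 1))
      (hT _ _ (by linarith) (by linarith) (by linarith) ?_)
      (f := fun u : ℝ => 2 * u - 1) (ContDiffOn.contMDiffOn (by fun_prop)) ?_)
      fun u hu => hright u (ha2.trans hu.1) (hu.2.trans hb)
    · intro c hc hcI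
      refine hmiss ((c + 1) / 2) ?_ ⟨by linarith [hcI.1], by linarith [hcI.2]⟩
      simp only [Finset.mem_union, Finset.mem_image]
      exact .inr ⟨c, hc, rfl⟩
    · intro u hu
      exact ⟨by linarith [hu.1], by linarith [hu.2]⟩

theorem concat_zero {M : Type u} (σ τ : unitInterval → M) : concat σ τ 0 = σ 0 := by
  simp [concat]

theorem concat_one {M : Type u} (σ τ : unitInterval → M) : concat σ τ 1 = τ 1 := by
  have e : (2 : ℝ) * 1 - 1 = 1 := by norm_num
  have e' : ¬ (1 : ℝ) ≤ 1 / 2 := by norm_num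
  simp only [concat, Set.Icc.coe_one, if_neg e', e, Set.IccExtend_right]
  rfl

theorem concat_mem {M : Type u} {σ τ : unitInterval → M} {U : Set M} (hσ : ∀ t, σ t ∈ U) (hτ : ∀ t, τ t ∈ U)
    (t : unitInterval) : concat σ τ t ∈ U := by
  unfold concat
  split_ifs
  · exact hσ _
  · exact hτ _

theorem pathCls_comp {σ τ : unitInterval → M} (hσ : PiecewiseSmooth E σ)
    (hτ : PiecewiseSmooth E τ) (h0 : σ 0 = x) (h1 : σ 1 = y) (h2 : τ 0 = y) (h3 : τ 1 = z) :
    (pathCls G σ hσ h0 h1).comp (pathCls G τ hτ h2 h3) =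
      pathCls G (concat σ τ) (hσ.concat hτ (h1.trans h2.symm))
        ((concat_zero σ τ).trans h0) ((concat_one σ τ).trans h3) :=
  Quot.sound (RawStep.concat_head σ τ [])

theorem pathCls_eq_of_homotopy (D : unitInterval → unitInterval → M)
    (hD : Continuous (uncurry D)) (hps : ∀ s, PiecewiseSmooth E (D s)) (h0 : ∀ s, D s 0 = x)
    (h1 : ∀ s, D s 1 = y) :
    pathCls G (D 0) (hps 0) (h0 0) (h1 0) = pathCls G (D 1) (hps 1) (h0 1) (h1 1) :=
  Quot.sound (RawStep.deform _ _ ⟨D, [], hD, by simp, fun s => ⟨hps s, h0 s, h1 s⟩, rfl, rfl⟩)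

/-- Constant path, unit, constant path is the composite of two constant `G`-paths, and the
concatenation move contracts it. -/
theorem arrCls_one (x : M) (h0 : G.src (G.one x) = x) (h1 : G.tgt (G.one x) = x) :
    arrCls E G (G.one x) h0 h1 = HClass.one E G x := by
  have := Quot.sound (r := fun p q : GPath E G x x => RawStep E G x x p.1 q.1)
    (a := GPath.comp (GPath.const E G x) (GPath.const E G x))
    (b := ⟨⟨concat (fun _ => x) (fun _ => x), []⟩, by
      rw [concat_const fun _ => x]; exact (GPath.const E G x).2⟩)
    (RawStep.concat_head _ _ [])
  exact (congrArg _ (Subtype.ext (by simp [GPath.comp, GPath.const, RawGPath.comp, endOf]))).trans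
    (this.trans (congrArg _ (Subtype.ext (by simp [GPath.const, concat_const fun _ => x]))))

/-- The composite reads `g`, unit, `h`, separated by constant paths: one multiplication move absorbs
the unit into `g`, a second one multiplies `g` and `h`. -/
theorem arrCls_comp {g h : A} (h0 : G.src g = x) (h1 : G.tgt g = y) (h2 : G.src h = y)
    (h3 : G.tgt h = z) :
    (arrCls E G g h0 h1).comp (arrCls E G h h2 h3) =
      arrCls E G (G.mul h g) ((G.src_mul _ _ (h2.trans h1.symm)).trans h0)
        ((G.tgt_mul _ _ (h2.trans h1.symm)).trans h3) := by
  have e : G.mul (G.one y) g = g := by rw [← h1, G.one_mul]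
  have c2 : IsGPath E G x z ⟨fun _ => x, [(g, fun _ => y), (h, fun _ => z)]⟩ :=
    ⟨⟨.const x, h0, h1, .const y, h2, h3, .const z⟩, rfl, rfl⟩
  refine Eq.trans (b := GPath.cls ⟨_, c2⟩) (Quot.sound ?_) (Quot.sound ?_)
  · have := RawStep.mul (E := E) (G := G) (x := x) (y := z) (fun _ => x) [] g (fun _ => y)
      (G.one y) (fun _ => y) [(h, fun _ => z)] (fun _ => rfl) ((G.src_one y).trans h1.symm)
    rw [e] at this
    exact this
  · exact RawStep.mul (E := E) (G := G) (x := x) (y := z) (fun _ => x) [] g (fun _ => y)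
      h (fun _ => z) [] (fun _ => rfl) (h2.trans h1.symm)

/-- The decomposition of the class of a `G`-path along its first path and its first arrow. -/
theorem cls_cons {σ τ : unitInterval → M} {g : A} {l : List (A × (unitInterval → M))}
    (h : IsChain E G σ ((g, τ) :: l)) (h0 : σ 0 = x) (h1 : endOf τ l = y) :
    GPath.cls (⟨⟨σ, (g, τ) :: l⟩, h, h0, h1⟩ : GPath E G x y) =
      (pathCls G σ h.1 h0 rfl).comp ((arrCls E G g h.2.1 h.2.2.1).comp
        (GPath.cls ⟨⟨τ, l⟩, h.2.2.2, rfl, h1⟩)) := by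
  obtain ⟨a1, a2, a3, a4⟩ := id h
  -- The composite on the right has a unit on either side of `g`, next to constant paths. `c1` is
  -- what remains once the first unit is absorbed.
  have c1 : IsGPath E G x y ⟨σ, (g, fun _ => τ 0) :: (G.one (τ 0), τ) :: l⟩ :=
    ⟨⟨a1, a2, a3, .const _, G.src_one _, G.tgt_one _, a4⟩, h0, h1⟩
  have e1 : G.mul g (G.one (σ 1)) = g := by rw [← a2, G.mul_one]
  have e2 : G.mul (G.one (τ 0)) g = g := by rw [← a3, G.one_mul]
  refine (Eq.trans (b := GPath.cls ⟨_, c1⟩) (Quot.sound ?_) (Quot.sound ?_)).symm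
  · have := RawStep.mul (E := E) (G := G) (x := x) (y := y) σ [] (G.one (σ 1)) (fun _ => σ 1)
      g (fun _ => τ 0) ((G.one (τ 0), τ) :: l) (fun _ => rfl) (a2.trans (G.tgt_one _).symm)
    rw [e1] at this
    exact this
  · have := RawStep.mul (E := E) (G := G) (x := x) (y := y) σ [] g (fun _ => τ 0)
      (G.one (τ 0)) τ l (fun _ => rfl) ((G.src_one _).trans a3.symm)
    rw [e2] at this
    exact this

/-- The class of a `G`-path of order one. -/
theorem cls_single {x' y' : M} {σ τ : unitInterval → M} {g : A} (hσ : PiecewiseSmooth E σ)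
    (hτ : PiecewiseSmooth E τ) (h0 : G.src g = x') (h1 : G.tgt g = y') (hx : σ 0 = x)
    (hx' : σ 1 = x') (hy' : τ 0 = y') (hy : τ 1 = y) (hc : IsGPath E G x y ⟨σ, [(g, τ)]⟩) :
    GPath.cls ⟨_, hc⟩ =
      (pathCls G σ hσ hx hx').comp ((arrCls E G g h0 h1).comp (pathCls G τ hτ hy' hy)) := by
  subst hx' hy'
  exact cls_cons hc.1 hx hy

end FundamentalGroupoid

/-! ### Inverses in a groupoid -/

namespace Gpd

variable {M : Type u} {A : Type v} (G : Gpd M A)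

theorem eq_inv_of_mul_eq_one {g h : A} (hc : G.src g = G.tgt h)
    (e : G.mul g h = G.one (G.src h)) : G.inv h = g := by
  rw [← G.mul_one g, hc, ← G.mul_inv, ← G.mul_assoc _ _ _ hc (G.tgt_inv h).symm, e,
    ← G.tgt_inv h, G.one_mul]

theorem inv_one (x : M) : G.inv (G.one x) = G.one x := by
  refine G.eq_inv_of_mul_eq_one (by rw [G.src_one, G.tgt_one]) ?_
  have := G.one_mul (G.one x)
  rw [G.tgt_one] at this
  rw [this, G.src_one]

theorem inv_mul_rev {g h : A} (hc : G.src g = G.tgt h) :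
    G.inv (G.mul g h) = G.mul (G.inv h) (G.inv g) := by
  have h1 : G.src (G.inv h) = G.tgt (G.inv g) := by rw [G.src_inv, G.tgt_inv, hc]
  have h2 : G.src (G.inv g) = G.tgt (G.mul g h) := by rw [G.src_inv, G.tgt_mul _ _ hc]
  refine G.eq_inv_of_mul_eq_one (by rw [G.src_mul _ _ h1, h2]) ?_
  rw [G.mul_assoc _ _ _ h1 h2, ← G.mul_assoc _ _ _ (G.src_inv g) hc, G.inv_mul, hc, G.one_mul,
    G.inv_mul, G.src_mul _ _ hc]

end Gpd

/-! ### Restrictions of paths to subintervals -/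

section Restriction

/-- The affine path from `a` to `b` in the unit interval. -/
def seg (a b s : unitInterval) : unitInterval :=
  ⟨(1 - s) * a + s * b, by
    have h1 := a.2.1; have h2 := a.2.2; have h3 := b.2.1; have h4 := b.2.2
    have h5 := s.2.1; have h6 := s.2.2
    constructor <;> nlinarith⟩

@[simp] theorem coe_seg (a b s : unitInterval) : (seg a b s : ℝ) = (1 - s) * a + s * b := rfl

@[simp] theorem seg_zero (a b : unitInterval) : seg a b 0 = a := by ext; simp

@[simp] theorem seg_one (a b : unitInterval) : seg a b 1 = b := by ext; simp

@[simp] theorem seg_self (a s : unitInterval) : seg a a s = a := by ext; simp; ring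

@[fun_prop] theorem continuous_seg {X : Type*} [TopologicalSpace X] {f g h : X → unitInterval}
    (hf : Continuous f) (hg : Continuous g) (hh : Continuous h) :
    Continuous fun x => seg (f x) (g x) (h x) := by
  rw [continuous_induced_rng]
  simp only [Function.comp_def, coe_seg]
  fun_prop

theorem seg_mem_uIcc (a b s : unitInterval) : seg a b s ∈ Set.uIcc a b := by
  rcases le_total a b with h | h
  · rw [Set.uIcc_of_le h]
    have h' : (a : ℝ) ≤ b := h
    constructor <;> rw [← Subtype.coe_le_coe, coe_seg] <;> nlinarith [s.2.1, s.2.2]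
  · rw [Set.uIcc_of_ge h]
    have h' : (b : ℝ) ≤ a := h
    constructor <;> rw [← Subtype.coe_le_coe, coe_seg] <;> nlinarith [s.2.1, s.2.2]

variable {E : Type*} [NormedAddCommGroup E] [NormedSpace ℝ E]
  {M : Type u} [TopologicalSpace M] [ChartedSpace E M] {A : Type v} [TopologicalSpace A]
  {G : Gpd M A}

theorem PiecewiseSmooth.restrict {σ : unitInterval → M} (hσ : PiecewiseSmooth E σ)
    (a b : unitInterval) : PiecewiseSmooth E (fun t => σ (seg a b t)) :=
  hσ.reparam _ (b - a) a (b - a) a (fun t _ => by rw [coe_seg]; ring)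
    fun t _ => by rw [coe_seg]; ring

/-- This formula and the next put the concatenated parameter path in the affine form required by
`PiecewiseSmooth.reparam`. -/
theorem concat_seg_left (a b c : unitInterval) {t : unitInterval} (ht : (t : ℝ) ≤ 1 / 2) :
    ((concat (seg a b) (seg b c) t : unitInterval) : ℝ) = 2 * (b - a) * t + a := by
  have h0 := t.2.1
  rw [concat, if_pos ht, Set.IccExtend_of_mem _ _ ⟨by linarith, by linarith⟩, coe_seg]
  ring

theorem concat_seg_right (a b c : unitInterval) {t : unitInterval} (ht : 1 / 2 ≤ (t : ℝ)) :
    ((concat (seg a b) (seg b c) t : unitInterval) : ℝ) = 2 * (c - b) * t + (2 * b - c) := by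
  have h0 := t.2.2
  rcases ht.eq_or_lt with ht | ht
  · rw [concat_seg_left _ _ _ ht.ge, ← ht]
    ring
  · rw [concat, if_neg (not_le.2 ht), Set.IccExtend_of_mem _ _ ⟨by linarith, by linarith⟩, coe_seg]
    simp only
    ring

theorem continuous_concat_seg (a b c : unitInterval) : Continuous (concat (seg a b) (seg b c)) := by
  rw [continuous_induced_rng]
  have : Continuous fun t : unitInterval => if (t : ℝ) ≤ 1 / 2 then 2 * ((b : ℝ) - a) * t + a
      else 2 * ((c : ℝ) - b) * t + (2 * b - c) := by
    refine Continuous.if_le (by fun_prop) (by fun_prop) (by fun_prop) (by fun_prop) ?_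
    intro t ht
    rw [ht]
    ring
  convert this using 2 with t
  simp only [comp_apply]
  split_ifs with h
  · exact concat_seg_left a b c h
  · exact concat_seg_right a b c (not_le.1 h).le

/-- The class of the restriction of a path to the interval between `a` and `b`. -/
def restrictCls (G : Gpd M A) {σ : unitInterval → M} (hσ : PiecewiseSmooth E σ)
    (a b : unitInterval) : HClass E G (σ a) (σ b) :=
  pathCls G (fun t => σ (seg a b t)) (hσ.restrict a b) (by rw [seg_zero]) (by rw [seg_one])

/-- Both sides are `σ` composed with parameter paths from `a` to `c`; the straight-line homotopy
between these stays affine on each half. The order of `a`, `b`, `c` plays no role, so reversed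
segments are inverses. -/
theorem restrictCls_comp {σ : unitInterval → M} (hσ : PiecewiseSmooth E σ)
    (a b c : unitInterval) :
    (restrictCls G hσ a b).comp (restrictCls G hσ b c) = restrictCls G hσ a c := by
  have key := pathCls_eq_of_homotopy (G := G) (x := σ a) (y := σ c)
    (fun s t => σ (seg (concat (seg a b) (seg b c) t) (seg a c t) s))
    (hσ.1.comp (continuous_seg ((continuous_concat_seg a b c).comp continuous_snd)
      (by fun_prop) continuous_fst))
    (fun s => hσ.reparam _ ((1 - s) * (2 * (b - a)) + s * (c - a)) ((1 - s) * a + s * a)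
      ((1 - s) * (2 * (c - b)) + s * (c - a)) ((1 - s) * (2 * b - c) + s * a)
      (fun t ht => by rw [coe_seg, coe_seg a c, concat_seg_left _ _ _ ht]; ring)
      fun t ht => by rw [coe_seg, coe_seg a c, concat_seg_right _ _ _ ht]; ring)
    (fun s => by rw [concat_zero, seg_zero, seg_zero, seg_self])
    (fun s => by rw [concat_one, seg_one, seg_one, seg_self])
  refine (pathCls_comp _ _ _ _ _ _).trans ?_
  refine Eq.trans ?_ (key.trans ?_)
  · simp only [seg_zero]
    congr 1
    exact (map_concat σ (seg a b) (seg b c)).symm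
  · simp only [seg_one]
    rfl

theorem restrictCls_self {σ : unitInterval → M} (hσ : PiecewiseSmooth E σ) (a : unitInterval) :
    restrictCls G hσ a a = HClass.one E G (σ a) := by
  simp only [restrictCls, seg_self]
  rfl

theorem restrictCls_zero_one {σ : unitInterval → M} (hσ : PiecewiseSmooth E σ) :
    restrictCls G hσ 0 1 = pathCls G σ hσ rfl rfl := by
  have : ∀ t, seg 0 1 t = t := fun t => by ext; simp
  simp only [restrictCls, this]

end Restriction

/-! ### Simple open sets -/

section Simple

variable (E : Type*) [NormedAddCommGroup E] [NormedSpace ℝ E]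
  {M : Type u} [TopologicalSpace M] [ChartedSpace E M]

/-- An open set which can be joined up by paths depending continuously on their end points, and
in which two piecewise smooth paths with the same end points are homotopic through piecewise smooth
paths of `M`. -/
structure IsSimple (U : Set M) : Prop where
  isOpen : IsOpen U
  exists_comb : ∃ ℓ : M → M → unitInterval → M,
    ContinuousOn (fun p : (M × M) × unitInterval => ℓ p.1.1 p.1.2 p.2) ((U ×ˢ U) ×ˢ Set.univ) ∧
    ∀ y ∈ U, ∀ z ∈ U, PiecewiseSmooth E (ℓ y z) ∧ ℓ y z 0 = y ∧ ℓ y z 1 = z ∧ ∀ t, ℓ y z t ∈ U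
  exists_homotopy : ∀ σ τ : unitInterval → M, PiecewiseSmooth E σ → PiecewiseSmooth E τ →
    (∀ t, σ t ∈ U) → (∀ t, τ t ∈ U) → σ 0 = τ 0 → σ 1 = τ 1 →
    ∃ D : unitInterval → unitInterval → M, Continuous (uncurry D) ∧
      (∀ s, PiecewiseSmooth E (D s)) ∧ (∀ s, D s 0 = σ 0) ∧ (∀ s, D s 1 = σ 1) ∧ D 0 = σ ∧ D 1 = τ

/-- Simple open sets form a basis of the topology: preimages of balls under charts are simple. -/
theorem exists_isSimple [IsManifold 𝓘(ℝ, E) ∞ M] {W : Set M} (hW : IsOpen W) {x : M}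
    (hx : x ∈ W) : ∃ U, IsSimple E U ∧ x ∈ U ∧ U ⊆ W := by
  set φ := chartAt E x with hφ
  have hxφ : x ∈ φ.source := mem_chart_source E x
  have hn : φ.target ∩ φ.symm ⁻¹' W ∈ nhds (φ x) :=
    (φ.isOpen_inter_preimage_symm hW).mem_nhds
      ⟨φ.map_source hxφ, by rwa [Set.mem_preimage, φ.left_inv hxφ]⟩
  obtain ⟨ρ, hρ, hB⟩ := Metric.mem_nhds_iff.1 hn
  set B := Metric.ball (φ x) ρ with hBdef
  have hcv : Convex ℝ B := convex_ball _ _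
  have hB1 : B ⊆ φ.target := fun _ h => (hB h).1
  set U := φ.source ∩ φ ⁻¹' B with hU
  have hsymm : ∀ v ∈ B, φ.symm v ∈ U := fun v hv =>
    ⟨φ.map_target (hB1 hv), by rwa [Set.mem_preimage, φ.right_inv (hB1 hv)]⟩
  have hmix : ∀ {y z : M} (s : unitInterval), y ∈ U → z ∈ U →
      (1 - s : ℝ) • φ y + (s : ℝ) • φ z ∈ B := fun s hy hz =>
    hcv hy.2 hz.2 (by linarith [s.2.2]) s.2.1 (by ring)
  have hsm := contMDiffOn_chart (I := 𝓘(ℝ, E)) (n := ∞) (x := x)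
  have hsm' := contMDiffOn_chart_symm (I := 𝓘(ℝ, E)) (n := ∞) (x := x)
  refine ⟨U, ⟨φ.isOpen_inter_preimage Metric.isOpen_ball, ?_, ?_⟩,
    ⟨hxφ, Metric.mem_ball_self hρ⟩, ?_⟩
  -- Straight segments in the chart, which stay in the ball by convexity.
  · refine ⟨fun y z t => φ.symm ((1 - t : ℝ) • φ y + (t : ℝ) • φ z), ?_, ?_⟩
    · refine φ.symm.continuousOn.comp (t := φ.target) ?_ ?_
      · have h1 : ContinuousOn (fun p : (M × M) × unitInterval => φ p.1.1)
            ((U ×ˢ U) ×ˢ Set.univ) :=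
          φ.continuousOn.comp (by fun_prop) fun p hp => hp.1.1.1
        have h2 : ContinuousOn (fun p : (M × M) × unitInterval => φ p.1.2)
            ((U ×ˢ U) ×ˢ Set.univ) :=
          φ.continuousOn.comp (by fun_prop) fun p hp => hp.1.2.1
        have h3 : Continuous (fun p : (M × M) × unitInterval => (p.2 : ℝ)) := by fun_prop
        exact ((continuousOn_const.sub h3.continuousOn).smul h1).add (h3.continuousOn.smul h2)
      · exact fun p hp => hB1 (hmix p.2 hp.1.1 hp.1.2)
    · intro y hy z hz
      refine ⟨⟨?_, ∅, fun a b ha hab hb _ => ?_⟩, ?_, ?_, fun t => hsymm _ (hmix t hy hz)⟩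
      · refine φ.symm.continuousOn.comp_continuous (by fun_prop) fun t => hB1 (hmix t hy hz)
      · have h1 : ContMDiffOn 𝓘(ℝ, ℝ) 𝓘(ℝ, E) ∞ (fun u : ℝ => (1 - u) • φ y + u • φ z)
            (Set.Icc a b) := ContDiffOn.contMDiffOn (by fun_prop)
        refine ContMDiffOn.congr (hsm'.comp h1 ?_) ?_
        · intro u hu
          exact hB1 (hmix ⟨u, ha.trans hu.1, hu.2.trans hb⟩ hy hz)
        · intro u hu
          rw [Set.IccExtend_of_mem _ _ ⟨ha.trans hu.1, hu.2.trans hb⟩]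
          rfl
      · simp [φ.left_inv hy.1]
      · simp [φ.left_inv hz.1]
  · intro σ τ ⟨hσ, S, hS⟩ ⟨hτ, T, hT⟩ hσU hτU h0 h1
    -- The straight-line homotopy in the chart; its stages are smooth away from the break points of
    -- both paths.
    refine ⟨fun s t => φ.symm ((1 - s : ℝ) • φ (σ t) + (s : ℝ) • φ (τ t)), ?_, ?_, ?_, ?_, ?_, ?_⟩
    · have c1 : Continuous fun t => φ (σ t) :=
        φ.continuousOn.comp_continuous hσ fun t => (hσU t).1
      have c2 : Continuous fun t => φ (τ t) :=
        φ.continuousOn.comp_continuous hτ fun t => (hτU t).1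
      refine φ.symm.continuousOn.comp_continuous ?_ fun p => hB1 (hmix p.1 (hσU _) (hτU _))
      exact ((by fun_prop : Continuous fun p : unitInterval × unitInterval => (1 - p.1 : ℝ)).smul
        (c1.comp continuous_snd)).add ((by fun_prop : Continuous
          fun p : unitInterval × unitInterval => (p.1 : ℝ)).smul (c2.comp continuous_snd))
    · intro s
      classical
      have c1 : Continuous fun t => φ (σ t) :=
        φ.continuousOn.comp_continuous hσ fun t => (hσU t).1
      have c2 : Continuous fun t => φ (τ t) :=
        φ.continuousOn.comp_continuous hτ fun t => (hτU t).1
      refine ⟨φ.symm.continuousOn.comp_continuous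
        ((continuous_const.smul c1).add (continuous_const.smul c2))
        fun t => hB1 (hmix s (hσU t) (hτU t)), S ∪ T, fun a b ha hab hb hm => ?_⟩
      have d1 := hsm.comp (hS a b ha hab hb fun c hc => hm c (Finset.mem_union_left _ hc))
        fun u _ => (hσU _).1
      have d2 := hsm.comp (hT a b ha hab hb fun c hc => hm c (Finset.mem_union_right _ hc))
        fun u _ => (hτU _).1
      have L : ∀ r : ℝ, ContMDiff 𝓘(ℝ, E) 𝓘(ℝ, E) ∞ (fun v : E => r • v) := fun r =>
        ContDiff.contMDiff (by fun_prop)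
      exact hsm'.comp (((L (1 - s)).comp_contMDiffOn d1).add ((L s).comp_contMDiffOn d2))
        fun u _ => hB1 (hmix s (hσU _) (hτU _))
    · intro s
      simp only [← h0]
      rw [← add_smul, sub_add_cancel, one_smul, φ.left_inv (hσU 0).1]
    · intro s
      simp only [← h1]
      rw [← add_smul, sub_add_cancel, one_smul, φ.left_inv (hσU 1).1]
    · funext t
      simp [φ.left_inv (hσU t).1]
    · funext t
      simp [φ.left_inv (hτU t).1]
  · intro y hy
    have := (hB hy.2).2
    rwa [Set.mem_preimage, φ.left_inv hy.1] at this

end Simple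

/-! ### Classes of paths inside an open set -/

section Inside

variable {E : Type*} [NormedAddCommGroup E] [NormedSpace ℝ E]
  {M : Type u} [TopologicalSpace M] [ChartedSpace E M] {A : Type v} [TopologicalSpace A]
  {G : Gpd M A} {x y z : M} {U : Set M}

/-- A class which is represented by a path inside `U`. -/
def HClass.Inside (U : Set M) (c : HClass E G x y) : Prop :=
  ∃ (σ : unitInterval → M) (hσ : PiecewiseSmooth E σ) (h0 : σ 0 = x) (h1 : σ 1 = y),
    (∀ t, σ t ∈ U) ∧ c = pathCls G σ hσ h0 h1

theorem HClass.Inside.right_mem {c : HClass E G x y} (h : c.Inside U) : y ∈ U := by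
  obtain ⟨σ, hσ, h0, rfl, hU, -⟩ := h
  exact hU 1

theorem HClass.Inside.mono {V : Set M} {c : HClass E G x y} (h : c.Inside U) (hUV : U ⊆ V) :
    c.Inside V := by
  obtain ⟨σ, hσ, h0, h1, hU, e⟩ := h
  exact ⟨σ, hσ, h0, h1, fun t => hUV (hU t), e⟩

theorem HClass.inside_one (hx : x ∈ U) : (HClass.one E G x).Inside U :=
  ⟨fun _ => x, .const x, rfl, rfl, fun _ => hx, rfl⟩

theorem HClass.Inside.comp {c : HClass E G x y} {d : HClass E G y z} (hc : c.Inside U)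
    (hd : d.Inside U) : (c.comp d).Inside U := by
  obtain ⟨σ, hσ, h0, h1, hU, rfl⟩ := hc
  obtain ⟨τ, hτ, h2, h3, hU', rfl⟩ := hd
  exact ⟨_, _, _, _, concat_mem hU hU', pathCls_comp hσ hτ h0 h1 h2 h3⟩

/-- The inverse is represented by the reversed path: going from `0` to `1` and back is the
restriction from `0` to `0`, a unit. -/
theorem HClass.Inside.inv {c : HClass E G x y} (hc : c.Inside U) : c.inv.Inside U := by
  obtain ⟨σ, hσ, rfl, rfl, hU, rfl⟩ := hc
  refine ⟨fun t => σ (seg 1 0 t), hσ.restrict 1 0, by simp, by simp, fun t => hU _, ?_⟩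
  refine HClass.inv_eq_of_comp_eq_one ?_
  rw [← restrictCls_zero_one]
  exact (restrictCls_comp hσ 0 1 0).trans (restrictCls_self hσ 0)

/-- The homotopy provided by simplicity is a deformation of order zero. This uniqueness is what
makes sheets over simple sets injective. -/
theorem IsSimple.inside_unique (hU : IsSimple E U) {c d : HClass E G x y} (hc : c.Inside U)
    (hd : d.Inside U) : c = d := by
  obtain ⟨σ, hσ, rfl, rfl, hσU, rfl⟩ := hc
  obtain ⟨τ, hτ, h2, h3, hτU, rfl⟩ := hd
  obtain ⟨D, hD, hps, hD0, hD1, rfl, rfl⟩ := hU.exists_homotopy σ τ hσ hτ hσU hτU h2.symm h3.symm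
  exact pathCls_eq_of_homotopy D hD hps hD0 hD1

theorem IsSimple.exists_inside (G : Gpd M A) (hU : IsSimple E U) (hx : x ∈ U) (hy : y ∈ U) :
    ∃ c : HClass E G x y, c.Inside U := by
  obtain ⟨ℓ, -, hℓ⟩ := hU.exists_comb
  obtain ⟨h1, h2, h3, h4⟩ := hℓ x hx y hy
  exact ⟨pathCls G _ h1 h2 h3, _, h1, h2, h3, h4, rfl⟩

theorem restrictCls_inside {σ : unitInterval → M} (hσ : PiecewiseSmooth E σ) {a b : unitInterval}
    (h : ∀ t ∈ Set.uIcc a b, σ t ∈ U) : (restrictCls G hσ a b).Inside U :=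
  ⟨_, _, _, _, fun t => h _ (seg_mem_uIcc a b t), rfl⟩

end Inside

/-! ### The space of cosets of homotopy classes -/

section Cover

variable {E : Type*} [NormedAddCommGroup E] [NormedSpace ℝ E]
  {M : Type u} [TopologicalSpace M] [ChartedSpace E M] {A : Type v} [TopologicalSpace A]
  {G : Gpd M A} {x₀ : M}

/-- Classes of `G`-paths from `x₀` to `x` up to left multiplication by elements of `H`. -/
def cosetSetoid (H : Subgroup (FundGroup E G x₀)) (x : M) : Setoid (HClass E G x₀ x) where
  r a b := ∃ h ∈ H, b = HClass.comp h a
  iseqv :=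
    { refl := fun a => ⟨1, H.one_mem, (HClass.one_comp a).symm⟩
      symm := by
        rintro a b ⟨h, hh, rfl⟩
        refine ⟨h⁻¹, H.inv_mem hh, ?_⟩
        have e : HClass.comp (h⁻¹ : FundGroup E G x₀) h = HClass.one E G x₀ := inv_mul_cancel h
        exact ((HClass.comp_assoc _ _ _).symm.trans
          ((congrArg (HClass.comp · a) e).trans (HClass.one_comp a))).symm
      trans := by
        rintro a b c ⟨h, hh, rfl⟩ ⟨k, hk, rfl⟩
        exact ⟨k * h, H.mul_mem hk hh, (HClass.comp_assoc _ _ _).symm⟩ }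

/-- The covering space of `M` associated with the subgroup `H`, as a set. -/
def Cover (H : Subgroup (FundGroup E G x₀)) : Type (max u v) :=
  Σ x : M, Quotient (cosetSetoid H x)

namespace Cover

variable {H : Subgroup (FundGroup E G x₀)} {x y z : M} {U V : Set M}

/-- The projection to `M`. -/
def proj (e : Cover H) : M := e.1

variable (H) in
/-- The coset of a class. -/
def mk (a : HClass E G x₀ x) : Cover H := ⟨x, Quotient.mk _ a⟩

variable (H) in
/-- The base point. -/
def base : Cover H := mk H (HClass.one E G x₀)

theorem exists_mk (e : Cover H) : ∃ (x : M) (a : HClass E G x₀ x), e = mk H a := by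
  obtain ⟨x, q⟩ := e
  induction q using Quotient.ind with | _ a
  exact ⟨x, a, rfl⟩

theorem mk_eq_mk {a b : HClass E G x₀ x} : mk H a = mk H b ↔ ∃ h ∈ H, b = HClass.comp h a := by
  constructor
  · intro h
    exact Quotient.exact (eq_of_heq (Sigma.mk.inj h).2)
  · intro h
    exact congrArg (Sigma.mk x) (Quotient.sound h)

/-- Transport of a point of the covering space along a homotopy class. -/
def ext (e : Cover H) (c : HClass E G e.proj y) : Cover H :=
  ⟨y, Quotient.map (fun a => HClass.comp a c) (by
    rintro a b ⟨h, hh, rfl⟩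
    exact ⟨h, hh, HClass.comp_assoc _ _ _⟩) e.2⟩

@[simp] theorem proj_ext (e : Cover H) (c : HClass E G e.proj y) : (e.ext c).proj = y := rfl

theorem base_ext (c : HClass E G x₀ x) : (base H).ext c = mk H c :=
  congrArg (mk H) (HClass.one_comp c)

theorem ext_one (e : Cover H) : e.ext (HClass.one E G e.proj) = e := by
  obtain ⟨x, a, rfl⟩ := e.exists_mk
  exact congrArg (mk H) a.comp_one

theorem ext_ext (e : Cover H) (c : HClass E G e.proj y) (d : HClass E G y z) :
    (e.ext c).ext d = e.ext (c.comp d) := by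
  obtain ⟨x, a, rfl⟩ := e.exists_mk
  exact congrArg (mk H) (a.comp_assoc c d)

/-- The type of a class records its end points. This compares transports along one sequence whose
end points are given by different expressions. -/
theorem ext_cls_congr {e e' : Cover H} (h : e = e') {y y' : M} {p : RawGPath M A}
    (hp : IsGPath E G e.proj y p) (hp' : IsGPath E G e'.proj y' p) :
    e.ext (GPath.cls ⟨p, hp⟩) = e'.ext (GPath.cls ⟨p, hp'⟩) := by
  obtain rfl : y = y' := hp.2.2.symm.trans hp'.2.2
  subst h
  rfl

/-- A set is open if it is stable under transport along short paths. -/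
instance : TopologicalSpace (Cover H) where
  IsOpen S := ∀ e ∈ S, ∃ V, IsOpen V ∧ e.proj ∈ V ∧
    ∀ (y : M) (c : HClass E G e.proj y), c.Inside V → e.ext c ∈ S
  isOpen_univ _ _ := ⟨Set.univ, isOpen_univ, trivial, fun _ _ _ => trivial⟩
  isOpen_inter S T hS hT e he := by
    obtain ⟨V, h1, h2, h3⟩ := hS e he.1
    obtain ⟨W, h4, h5, h6⟩ := hT e he.2
    exact ⟨V ∩ W, h1.inter h4, ⟨h2, h5⟩, fun y c hc =>
      ⟨h3 y c (hc.mono Set.inter_subset_left), h6 y c (hc.mono Set.inter_subset_right)⟩⟩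
  isOpen_sUnion 𝒮 h𝒮 e he := by
    obtain ⟨S, hS, he⟩ := he
    obtain ⟨V, h1, h2, h3⟩ := h𝒮 S hS e he
    exact ⟨V, h1, h2, fun y c hc => ⟨S, hS, h3 y c hc⟩⟩

/-- The points which are reached from `e` along paths inside `U`. -/
def sheet (U : Set M) (e : Cover H) : Set (Cover H) :=
  {e' | ∃ (y : M) (c : HClass E G e.proj y), c.Inside U ∧ e.ext c = e'}

theorem ext_mem_sheet {e : Cover H} {c : HClass E G e.proj y} (hc : c.Inside U) :
    e.ext c ∈ sheet U e := ⟨y, c, hc, rfl⟩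

theorem self_mem_sheet {e : Cover H} (he : e.proj ∈ U) : e ∈ sheet U e :=
  ⟨_, _, HClass.inside_one he, e.ext_one⟩

theorem isOpen_sheet (hU : IsOpen U) (e : Cover H) : IsOpen (sheet U e) := by
  rintro _ ⟨y, c, hc, rfl⟩
  refine ⟨U, hU, hc.right_mem, fun z d hd => ?_⟩
  exact ⟨z, HClass.comp c d, hc.comp hd, (ext_ext e c d).symm⟩

/-- The sheets through `e` over open neighbourhoods of its projection form a neighbourhood basis,
being open and contained in each open set around `e` once small enough. -/
theorem mem_nhds_iff {S : Set (Cover H)} {e : Cover H} :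
    S ∈ nhds e ↔ ∃ V, IsOpen V ∧ e.proj ∈ V ∧ sheet V e ⊆ S := by
  constructor
  · intro h
    obtain ⟨T, hTS, hT, he⟩ := _root_.mem_nhds_iff.1 h
    obtain ⟨V, h1, h2, h3⟩ := hT e he
    refine ⟨V, h1, h2, ?_⟩
    rintro _ ⟨y, c, hc, rfl⟩
    exact hTS (h3 y c hc)
  · rintro ⟨V, h1, h2, h3⟩
    exact Filter.mem_of_superset ((isOpen_sheet h1 e).mem_nhds (self_mem_sheet h2)) h3

/-- Classes represented inside `U` are closed under composition and inversion, so reachability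
inside `U` is symmetric and transitive: intersecting sheets over the same `U` coincide. -/
theorem sheet_eq_of_mem {e e' : Cover H} (h : e' ∈ sheet U e) : sheet U e' = sheet U e := by
  obtain ⟨y, c, hc, rfl⟩ := h
  ext f
  constructor
  · rintro ⟨z, d, hd, rfl⟩
    exact ⟨z, HClass.comp c d, hc.comp hd, (ext_ext e c d).symm⟩
  · rintro ⟨z, d, hd, rfl⟩
    refine ⟨z, HClass.comp c.inv d, hc.inv.comp hd, (ext_ext e c _).trans ?_⟩
    exact congrArg e.ext (c.comp_inv_comp d)

theorem sheet_injOn (hU : IsSimple E U) (e : Cover H) : Set.InjOn proj (sheet U e) := by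
  rintro _ ⟨y, c, hc, rfl⟩ _ ⟨z, d, hd, rfl⟩ h
  obtain rfl : y = z := h
  rw [hU.inside_unique hc hd]

theorem sheet_surjOn (hU : IsSimple E U) {e : Cover H} (he : e.proj ∈ U) :
    Set.SurjOn proj (sheet U e) U := by
  intro y hy
  obtain ⟨c, hc⟩ := hU.exists_inside G he hy
  exact ⟨e.ext c, ext_mem_sheet hc, rfl⟩

theorem continuous_proj : Continuous (proj : Cover H → M) := by
  refine continuous_def.2 fun V hV e he => ⟨V, hV, he, fun y c hc => ?_⟩
  exact hc.right_mem

/-! ### The projection as a covering map -/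

section Manifold

variable [IsManifold 𝓘(ℝ, E) ∞ M]

theorem isOpenMap_proj : IsOpenMap (proj : Cover H → M) := by
  refine IsOpenMap.of_nhds_le fun e S hS => ?_
  obtain ⟨V, h1, h2, h3⟩ := mem_nhds_iff.1 hS
  obtain ⟨U, hU, heU, hUV⟩ := exists_isSimple E h1 h2
  refine Filter.mem_of_superset (hU.isOpen.mem_nhds heU) fun y hy => ?_
  obtain ⟨c, hc⟩ := hU.exists_inside G heU hy
  exact h3 (ext_mem_sheet (hc.mono hUV))

theorem isCoveringMap_proj (hG : Connected E G) : IsCoveringMap (proj : Cover H → M) := by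
  -- `G`-connectedness enters here: no fibre is empty.
  have hne : ∀ x, Nonempty (Quotient (cosetSetoid H x)) := fun x =>
    (hG x₀ x).map fun p => Quotient.mk _ p.cls
  have : Nonempty (M → Cover H) := ⟨fun x => ⟨x, (hne x).some⟩⟩
  choose U hU hxU _ using fun x : M => exists_isSimple E isOpen_univ (Set.mem_univ x)
  let (x : M) : TopologicalSpace (Quotient (cosetSetoid H x)) := ⊥
  have (x : M) : DiscreteTopology (Quotient (cosetSetoid H x)) := ⟨rfl⟩
  -- `U x` is evenly covered by the sheets through the points of the fibre over `x`, which serves as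
  -- the discrete index set.
  refine IsCoveringMap.mk proj (fun x => Quotient (cosetSetoid H x)) (fun x =>
    (hU x).isOpen.trivializationDiscrete (fun q => sheet (U x) (⟨x, q⟩ : Cover H)) (U x) ?_
      (fun q => sheet_injOn (hU x) _) (fun q => sheet_surjOn (hU x) (hxU x)) ?_ ?_) hxU
  · intro q W hW
    constructor
    · intro h
      exact (h.preimage continuous_proj).inter (isOpen_sheet (hU x).isOpen _)
    · intro h
      convert isOpenMap_proj _ h
      refine Set.Subset.antisymm (fun y hy => ?_) ?_
      · obtain ⟨e, he, rfl⟩ := sheet_surjOn (hU x) (e := (⟨x, q⟩ : Cover H)) (hxU x) (hW hy)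
        exact ⟨e, ⟨hy, he⟩, rfl⟩
      · rintro _ ⟨e, he, rfl⟩
        exact he.1
  -- Intersecting sheets are equal, and one sheet meets the fibre over `x` only once.
  · intro q q' hqq
    refine Set.disjoint_left.2 fun e h h' => hqq ?_
    have h1 := sheet_eq_of_mem h
    rw [sheet_eq_of_mem h'] at h1
    have h2 : (⟨x, q⟩ : Cover H) ∈ sheet (U x) (⟨x, q'⟩ : Cover H) :=
      h1 ▸ self_mem_sheet (hxU x)
    exact eq_of_heq (Sigma.mk.inj
      (sheet_injOn (hU x) _ h2 (self_mem_sheet (hxU x)) rfl)).2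
  -- Moving `e` inside `U x` to the centre `x` gives the index of its sheet.
  · intro e he
    obtain ⟨c, hc⟩ := (hU x).exists_inside G he (hxU x)
    refine Set.mem_iUnion.2 ⟨(e.ext c).2, ?_⟩
    change e ∈ sheet (U x) (e.ext c)
    rw [sheet_eq_of_mem (ext_mem_sheet hc)]
    exact self_mem_sheet he

/-- Points of one fibre are separated because the projection is a covering map, other points by
preimages of disjoint open sets of `M`. -/
theorem t2Space [T2Space M] (hG : Connected E G) : T2Space (Cover H) := by
  refine ⟨fun e e' h => ?_⟩
  by_cases he : e.proj = e'.proj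
  · exact (isCoveringMap_proj hG).isSeparatedMap e e' he h
  · obtain ⟨u, v, hu, hv, h1, h2, h3⟩ := t2_separation he
    exact ⟨_, _, hu.preimage continuous_proj, hv.preimage continuous_proj, h1, h2,
      h3.preimage _⟩

end Manifold

/-- Transport along the initial segments of a path lifts this path. -/
theorem exists_lift (e : Cover H) {σ : unitInterval → M} (hσ : PiecewiseSmooth E σ)
    (h0 : σ 0 = e.proj) : ∃ ρ : unitInterval → Cover H, Continuous ρ ∧ (∀ t, (ρ t).proj = σ t) ∧
      ρ 0 = e ∧ ρ 1 = e.ext (pathCls G σ hσ h0 rfl) := by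
  obtain ⟨x, q⟩ := e
  obtain rfl : σ 0 = x := h0
  set e : Cover H := ⟨σ 0, q⟩
  refine ⟨fun t => e.ext (restrictCls G hσ 0 t), ?_, fun t => rfl, ?_, ?_⟩
  · refine continuous_iff_continuousAt.2 fun t₀ S hS => ?_
    obtain ⟨V, h1, h2, h3⟩ := mem_nhds_iff.1 hS
    -- On a small interval around `t₀` the path stays in `V`, so passing from time `t₀` to `t` is
    -- transport along a class inside `V`.
    obtain ⟨a, b, hab, hn, hs⟩ := exists_Icc_mem_subset_of_mem_nhds
      (hσ.1.continuousAt.preimage_mem_nhds (h1.mem_nhds h2))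
    refine Filter.mem_map.2 (Filter.mem_of_superset hn fun t ht => h3 ?_)
    change e.ext (restrictCls G hσ 0 t) ∈ sheet V (e.ext (restrictCls G hσ 0 t₀))
    exact ⟨_, restrictCls G hσ t₀ t, restrictCls_inside hσ fun u hu =>
      hs (Set.ordConnected_Icc.uIcc_subset hab ht hu),
      (ext_ext e _ _).trans (congrArg e.ext (restrictCls_comp hσ 0 t₀ t))⟩
  · exact (congrArg e.ext (restrictCls_self hσ 0)).trans e.ext_one
  · exact congrArg e.ext (restrictCls_zero_one hσ)

/-- The end point of a continuous path in the covering space is determined by its projection. -/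
theorem end_eq_ext [IsManifold 𝓘(ℝ, E) ∞ M] (hG : Connected E G) {ρ : unitInterval → Cover H}
    (hρ : Continuous ρ) (hσ : PiecewiseSmooth E fun t => (ρ t).proj) :
    ρ 1 = (ρ 0).ext (pathCls G (fun t => (ρ t).proj) hσ rfl rfl) := by
  obtain ⟨ρ', h1, h2, h3, h4⟩ := exists_lift (ρ 0) hσ rfl
  rw [← h4]
  -- Uniqueness of lifts over the connected unit interval.
  exact congrFun ((isCoveringMap_proj hG).eq_of_comp_eq hρ h1
    (funext fun t => (h2 t).symm) 0 h3.symm) 1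

end Cover

end Cover

/-! ### Lifting a manifold structure along a local homeomorphism -/

section LiftedCharts

variable {E : Type*} [NormedAddCommGroup E] [NormedSpace ℝ E]
  {M : Type*} [TopologicalSpace M] [ChartedSpace E M] {F : Type*} [TopologicalSpace F]
  {r : F → M}

/-- The charts of the base composed with local restrictions of a local homeomorphism. -/
@[reducible] noncomputable def liftedChartedSpace (E : Type*) [NormedAddCommGroup E] {M : Type*}
    [TopologicalSpace M] [ChartedSpace E M] {F : Type*} [TopologicalSpace F] {r : F → M}
    (hr : IsLocalHomeomorph r) : ChartedSpace E F where
  atlas := Set.range fun e => (hr e).choose ≫ₕ chartAt E (r e)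
  chartAt e := (hr e).choose ≫ₕ chartAt E (r e)
  mem_chart_source e := by
    rw [OpenPartialHomeomorph.trans_source]
    refine ⟨(hr e).choose_spec.1, ?_⟩
    rw [Set.mem_preimage, ← (hr e).choose_spec.2]
    exact mem_chart_source E (r e)
  chart_mem_atlas e := ⟨e, rfl⟩

/-- Each chosen local homeomorphism coincides with `r`, so `r` cancels its inverse, and the
coordinate changes are restrictions of those of `M`. -/
theorem liftedChartedSpace_isManifold [IsManifold 𝓘(ℝ, E) ∞ M] (hr : IsLocalHomeomorph r) :
    letI := liftedChartedSpace E hr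
    IsManifold 𝓘(ℝ, E) ∞ F := by
  let := liftedChartedSpace E hr
  refine isManifold_of_contDiffOn 𝓘(ℝ, E) ∞ F ?_
  rintro _ _ ⟨e, rfl⟩ ⟨e', rfl⟩
  have h := contDiffOn_ext_coord_change (I := 𝓘(ℝ, E)) (n := ∞) (r e') (r e)
  simp only [mfld_simps, (hr e').choose_spec.2.symm] at h ⊢
  refine (h.mono ?_).congr ?_
  · intro v hv
    have := (hr e).choose.right_inv hv.1.2
    rw [← (hr e).choose_spec.2] at this
    have h2 := hv.2.2
    simp only [Set.mem_preimage, comp_apply] at this h2 ⊢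
    rw [this] at h2
    exact ⟨hv.1.1, h2⟩
  · intro v hv
    have := (hr e).choose.right_inv hv.1.2
    rw [← (hr e).choose_spec.2] at this
    simp only [comp_apply] at this ⊢
    rw [this]

/-- In a lifted chart `f` has literally the same expression as `r ∘ f` in the chart below; only the
continuity of `f` is extra information. -/
theorem contMDiffWithinAt_lifted_iff {E₁ : Type*} [NormedAddCommGroup E₁] [NormedSpace ℝ E₁]
    {H₁ : Type*} [TopologicalSpace H₁] {I : ModelWithCorners ℝ E₁ H₁}
    {N : Type*} [TopologicalSpace N] [ChartedSpace H₁ N] (hr : IsLocalHomeomorph r) {f : N → F}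
    {s : Set N} {x : N} :
    letI := liftedChartedSpace E hr
    ContMDiffWithinAt I 𝓘(ℝ, E) ∞ f s x ↔
      ContinuousWithinAt f s x ∧ ContMDiffWithinAt I 𝓘(ℝ, E) ∞ (r ∘ f) s x := by
  let := liftedChartedSpace E hr
  have e : extChartAt 𝓘(ℝ, E) (f x) ∘ f = extChartAt 𝓘(ℝ, E) ((r ∘ f) x) ∘ (r ∘ f) := by
    funext y
    exact congrArg (chartAt E (r (f x))) (congrFun (hr (f x)).choose_spec.2 (f y)).symm
  rw [contMDiffWithinAt_iff_target, contMDiffWithinAt_iff_target (f := r ∘ f), e]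
  constructor
  · exact fun h => ⟨h.1, hr.continuous.continuousAt.comp_continuousWithinAt h.1, h.2⟩
  · exact fun h => ⟨h.1, h.2.2⟩

/-- A local inverse of `r` is continuous, and composing it with `r` gives the identity, so the
smoothness criterion applies to it. -/
theorem isLocalDiffeomorph_lifted (hr : IsLocalHomeomorph r) :
    letI := liftedChartedSpace E hr
    IsLocalDiffeomorph 𝓘(ℝ, E) 𝓘(ℝ, E) ∞ r := by
  let := liftedChartedSpace E hr
  have h : ContMDiff 𝓘(ℝ, E) 𝓘(ℝ, E) ∞ r := fun x =>
    ((contMDiffWithinAt_lifted_iff hr).1 (contMDiff_id (I := 𝓘(ℝ, E)) (M := F) x)).2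
  intro e
  obtain ⟨l, hl, he⟩ := hr e
  refine ⟨⟨l.toPartialEquiv, l.open_source, l.open_target, ?_, ?_⟩, hl, ?_⟩
  · exact h.contMDiffOn.congr fun x _ => (congrFun he x).symm
  · intro y hy
    refine (contMDiffWithinAt_lifted_iff hr).2 ⟨l.continuousOn_symm y hy, ?_⟩
    refine (contMDiff_id (I := 𝓘(ℝ, E)) (M := M) y).contMDiffWithinAt.congr (fun z hz => ?_) ?_
    · rw [he]; exact l.right_inv hz
    · rw [he]; exact l.right_inv hy
  · intro x _
    exact congrFun he x

end LiftedCharts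

/-! ### The action of the groupoid -/

section Action

variable {E : Type*} [NormedAddCommGroup E] [NormedSpace ℝ E]
  {M : Type u} [TopologicalSpace M] [ChartedSpace E M] {A : Type v} [TopologicalSpace A]
  {G : Gpd M A} {x₀ : M}

/-- Along a path of arrows with sources in `U` and targets in `V`, the classes of the inverse
arrows differ by classes of paths inside `U` and `V`. -/
theorem exists_inside_comp_arrCls (hs : Continuous G.src) (ht : Continuous G.tgt)
    (hi : Continuous G.inv) {U V : Set M} (hU : IsSimple E U) (hV : IsSimple E V)
    {γ : unitInterval → A} (hγ : Continuous γ) (hγU : ∀ s, G.src (γ s) ∈ U)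
    (hγV : ∀ s, G.tgt (γ s) ∈ V) {g g' : A} (h0 : γ 0 = g) (h1 : γ 1 = g') :
    ∃ (c : HClass E G (G.tgt g) (G.tgt g')) (d : HClass E G (G.src g) (G.src g')),
      c.Inside V ∧ d.Inside U ∧
      c.comp (arrCls E G (G.inv g') (G.src_inv g') (G.tgt_inv g')) =
        (arrCls E G (G.inv g) (G.src_inv g) (G.tgt_inv g)).comp d := by
  subst h0 h1
  obtain ⟨ℓ, cℓ, hℓ⟩ := hU.exists_comb
  obtain ⟨m, cm, hm⟩ := hV.exists_comb
  have aV : ∀ s, _ := fun s => hm _ (hγV 0) _ (hγV s)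
  have aU : ∀ s, _ := fun s => hℓ _ (hγU s) _ (hγU 1)
  -- At time `s`: go inside `V` from the target of `γ 0` to that of `γ s`, cross by the inverse of
  -- `γ s`, then go inside `U` to the source of `γ 1`. The end points do not depend on `s`, so this
  -- is a deformation.
  have hP : ∀ s, IsGPath E G (G.tgt (γ 0)) (G.src (γ 1))
      ⟨m (G.tgt (γ 0)) (G.tgt (γ s)), [(G.inv (γ s), ℓ (G.src (γ s)) (G.src (γ 1)))]⟩ :=
    fun s => ⟨⟨(aV s).1, (G.src_inv _).trans (aV s).2.2.1.symm,
      (G.tgt_inv _).trans (aU s).2.1.symm, (aU s).1⟩, (aV s).2.1, (aU s).2.2.1⟩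
  have key : GPath.cls ⟨_, hP 0⟩ = GPath.cls ⟨_, hP 1⟩ := by
    refine Quot.sound (RawStep.deform _ _ ⟨fun s => m (G.tgt (γ 0)) (G.tgt (γ s)),
      [(fun s => G.inv (γ s), fun s => ℓ (G.src (γ s)) (G.src (γ 1)))], ?_, ?_, hP, rfl, rfl⟩)
    · exact cm.comp_continuous (f := fun p : unitInterval × unitInterval =>
        ((G.tgt (γ 0), G.tgt (γ p.1)), p.2)) (by fun_prop)
        fun p => ⟨⟨hγV 0, hγV p.1⟩, trivial⟩
    · intro e he
      obtain rfl := List.mem_singleton.1 he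
      exact ⟨hi.comp hγ, cℓ.comp_continuous (f := fun p : unitInterval × unitInterval =>
        ((G.src (γ p.1), G.src (γ 1)), p.2)) (by fun_prop)
        fun p => ⟨⟨hγU p.1, hγU 1⟩, trivial⟩⟩
  rw [cls_single (aV 0).1 (aU 0).1 (G.src_inv _) (G.tgt_inv _) (aV 0).2.1 (aV 0).2.2.1
      (aU 0).2.1 (aU 0).2.2.1, cls_single (aV 1).1 (aU 1).1 (G.src_inv _) (G.tgt_inv _)
      (aV 1).2.1 (aV 1).2.2.1 (aU 1).2.1 (aU 1).2.2.1] at key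
  -- At `s = 0` the path in `V` is a loop, and at `s = 1` so is the path in `U`; simplicity makes
  -- both classes units.
  have i1 : (pathCls G _ (aV 0).1 (aV 0).2.1 (aV 0).2.2.1).Inside V :=
    ⟨_, _, _, _, (aV 0).2.2.2, rfl⟩
  have i2 : (pathCls G _ (aU 1).1 (aU 1).2.1 (aU 1).2.2.1).Inside U :=
    ⟨_, _, _, _, (aU 1).2.2.2, rfl⟩
  rw [hV.inside_unique i1 (HClass.inside_one (hγV 0)), HClass.one_comp,
    hU.inside_unique i2 (HClass.inside_one (hγU 1)), HClass.comp_one] at key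
  exact ⟨_, _, ⟨_, _, _, _, (aV 1).2.2.2, rfl⟩, ⟨_, _, _, _, (aU 0).2.2.2, rfl⟩, key.symm⟩

namespace Cover

variable {H : Subgroup (FundGroup E G x₀)} {y : M}

open Classical in
/-- The right action of the arrows: transport along the inverse arrow. -/
noncomputable def act (e : Cover H) (g : A) : Cover H :=
  if h : e.proj = G.tgt g then
    e.ext (arrCls E G (G.inv g) ((G.src_inv g).trans h.symm) (G.tgt_inv g))
  else e

theorem act_def {e : Cover H} {g : A} (h : e.proj = G.tgt g) :
    e.act g = e.ext (arrCls E G (G.inv g) ((G.src_inv g).trans h.symm) (G.tgt_inv g)) :=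
  dif_pos h

theorem proj_act {e : Cover H} {g : A} (h : e.proj = G.tgt g) : (e.act g).proj = G.src g := by
  rw [act_def h, proj_ext]

theorem ext_arrCls_congr {e e' : Cover H} (he : e = e') {g g' : A} (hg : g = g') {y' : M}
    (h0 : G.src g = e.proj) (h1 : G.tgt g = y) (h0' : G.src g' = e'.proj) (h1' : G.tgt g' = y') :
    e.ext (arrCls E G g h0 h1) = e'.ext (arrCls E G g' h0' h1') := by
  subst he hg h1 h1'
  rfl

theorem act_one (e : Cover H) : e.act (G.one e.proj) = e := by
  rw [act_def (G.tgt_one _).symm]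
  refine (ext_arrCls_congr rfl (G.inv_one _) _ _ (G.src_one _) (G.tgt_one _)).trans ?_
  rw [arrCls_one, ext_one]

/-- Inversion reverses products, which turns composition of transports into a right action. -/
theorem act_mul {e : Cover H} {g h : A} (hg : e.proj = G.tgt g) (hgh : G.src g = G.tgt h) :
    (e.act g).act h = e.act (G.mul g h) := by
  rw [act_def ((proj_act hg).trans hgh), act_def (hg.trans (G.tgt_mul _ _ hgh).symm)]
  have hh : G.src (G.inv h) = G.src g := (G.src_inv h).trans hgh.symm
  refine (ext_arrCls_congr (act_def hg) rfl _ _ hh (G.tgt_inv h)).trans ((ext_ext _ _ _).trans ?_)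
  refine (congrArg e.ext (arrCls_comp _ (G.tgt_inv g) hh _)).trans ?_
  exact ext_arrCls_congr rfl (G.inv_mul_rev hgh).symm _ _ _ _

/-- Crossing the arrow `(e, g)` of the action groupoid, from `e g` to `e`, amounts to transport
along `g`. Used to locate the end points of lifted `G`-paths. -/
theorem ext_arrCls_of_act_eq {e f : Cover H} {g : A} (h : e.proj = G.tgt g) (hf : e.act g = f)
    (h0 : G.src g = f.proj) (h1 : G.tgt g = y) : f.ext (arrCls E G g h0 h1) = e := by
  subst hf h1
  refine (ext_arrCls_congr (act_def h) rfl _ _ rfl rfl).trans ((ext_ext _ _ _).trans ?_)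
  refine (congrArg e.ext (arrCls_comp _ (G.tgt_inv g) rfl _)).trans ?_
  refine (ext_arrCls_congr rfl ((G.mul_inv g).trans (congrArg G.one h.symm)) _ _
    (G.src_one _) (G.tgt_one _)).trans ?_
  rw [arrCls_one, ext_one]

/-- The converse: transport along `g` provides the target of an arrow over `g` with prescribed
source, so arrows can be lifted. -/
theorem act_ext_arrCls {e : Cover H} {g : A} (h0 : G.src g = e.proj) (h1 : G.tgt g = y) :
    (e.ext (arrCls E G g h0 h1)).act g = e := by
  subst h1
  refine (act_def rfl).trans ((ext_ext _ _ _).trans ?_)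
  refine (congrArg e.ext (arrCls_comp _ rfl _ _)).trans ?_
  refine (ext_arrCls_congr rfl ((G.inv_mul g).trans (congrArg G.one h0)) _ _
    (G.src_one _) (G.tgt_one _)).trans ?_
  rw [arrCls_one, ext_one]

/-! ### Continuity of the action and the smooth structure of the covering -/

section Manifold

variable [IsManifold 𝓘(ℝ, E) ∞ M]

theorem continuousOn_act [LocallyPathConnectedSpace A] (hs : Continuous G.src)
    (ht : Continuous G.tgt) (hi : Continuous G.inv) :
    ContinuousOn (fun p : Cover H × A => p.1.act p.2) {p | p.1.proj = G.tgt p.2} := by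
  rintro ⟨⟨x, q⟩, g⟩ hp S hS
  obtain rfl : x = G.tgt g := hp
  set e : Cover H := ⟨G.tgt g, q⟩
  simp only at hS
  obtain ⟨U', h1, h2, h3⟩ := mem_nhds_iff.1 hS
  rw [proj_act rfl] at h2
  obtain ⟨U, hU, hgU, hUU'⟩ := exists_isSimple E h1 h2
  obtain ⟨V, hV, hgV, -⟩ := exists_isSimple E isOpen_univ (Set.mem_univ (G.tgt g))
  -- A path connected neighbourhood of `g` whose sources lie in `U` and targets in `V`: its arrows
  -- are joined to `g` by paths of such arrows.
  obtain ⟨W, ⟨hgW, hW, hWUV⟩, -⟩ := (pathConnected_subset_basis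
    ((hU.isOpen.preimage hs).inter (hV.isOpen.preimage ht)) ⟨hgU, hgV⟩).mem_iff.1
    ((hU.isOpen.preimage hs).inter (hV.isOpen.preimage ht) |>.mem_nhds ⟨hgU, hgV⟩)
  refine Filter.mem_map.2 (mem_nhdsWithin_iff_exists_mem_nhds_inter.2
    ⟨sheet V e ×ˢ W, prod_mem_nhds ((isOpen_sheet hV.isOpen e).mem_nhds (self_mem_sheet hgV)) hgW,
      ?_⟩)
  rintro ⟨_, g'⟩ ⟨⟨⟨y, c, hc, rfl⟩, hg'⟩, hy⟩
  obtain rfl : y = G.tgt g' := hy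
  refine h3 ?_
  obtain ⟨γ, hγ⟩ := hW.joinedIn g (mem_of_mem_nhds hgW) g' hg'
  obtain ⟨c', d, hc', hd, key⟩ := exists_inside_comp_arrCls (E := E) hs ht hi hU hV γ.continuous
    (fun s => (hWUV (hγ s)).1) (fun s => (hWUV (hγ s)).2) γ.source γ.target
  -- By simplicity of `V` the class leading to the nearby point is the one produced by the
  -- deformation. Hence acting by `g'` there is acting by `g` at `e`, followed by a short path `d`.
  obtain rfl := hV.inside_unique hc hc'
  have e1 : (e.ext c).act g' = (e.ext (arrCls E G (G.inv g) (G.src_inv g) (G.tgt_inv g))).ext d :=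
    (act_def rfl).trans ((ext_ext _ _ _).trans ((congrArg e.ext key).trans (ext_ext _ _ _).symm))
  have e2 : e.act g = e.ext (arrCls E G (G.inv g) (G.src_inv g) (G.tgt_inv g)) := act_def rfl
  change (e.ext c).act g' ∈ sheet U' (e.act g)
  rw [e1, e2]
  exact ext_mem_sheet (hd.mono hUU')

/-- Proved directly from the sheets rather than from the covering property, so that the charted
space instance does not depend on `G`-connectedness. -/
theorem isLocalHomeomorph_proj : IsLocalHomeomorph (proj : Cover H → M) := by
  refine isLocalHomeomorph_iff_isOpenEmbedding_restrict.2 fun e => ?_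
  obtain ⟨U, hU, heU, -⟩ := exists_isSimple E isOpen_univ (Set.mem_univ e.proj)
  have ho := isOpen_sheet hU.isOpen e
  refine ⟨sheet U e, ho.mem_nhds (self_mem_sheet heU), ?_⟩
  exact .of_continuous_injective_isOpenMap (continuous_proj.comp continuous_subtype_val)
    (Set.injOn_iff_injective.1 (sheet_injOn hU e)) (isOpenMap_proj.comp ho.isOpenMap_subtype_val)

noncomputable instance : ChartedSpace E (Cover H) := liftedChartedSpace E isLocalHomeomorph_proj

instance : IsManifold 𝓘(ℝ, E) ∞ (Cover H) := liftedChartedSpace_isManifold isLocalHomeomorph_proj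

theorem contMDiffWithinAt_iff {E₁ : Type*} [NormedAddCommGroup E₁] [NormedSpace ℝ E₁]
    {H₁ : Type*} [TopologicalSpace H₁] {I : ModelWithCorners ℝ E₁ H₁}
    {N : Type*} [TopologicalSpace N] [ChartedSpace H₁ N] {f : N → Cover H} {s : Set N} {n : N} :
    ContMDiffWithinAt I 𝓘(ℝ, E) ∞ f s n ↔
      ContinuousWithinAt f s n ∧ ContMDiffWithinAt I 𝓘(ℝ, E) ∞ (proj ∘ f) s n :=
  contMDiffWithinAt_lifted_iff isLocalHomeomorph_proj

theorem isLocalDiffeomorph_proj : IsLocalDiffeomorph 𝓘(ℝ, E) 𝓘(ℝ, E) ∞ (proj : Cover H → M) :=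
  isLocalDiffeomorph_lifted isLocalHomeomorph_proj

theorem piecewiseSmooth_of_proj {ρ : unitInterval → Cover H} (hρ : Continuous ρ)
    (h : PiecewiseSmooth E fun t => (ρ t).proj) : PiecewiseSmooth E ρ := by
  obtain ⟨-, S, hS⟩ := h
  refine ⟨hρ, S, fun a b ha hab hb hm u hu => contMDiffWithinAt_iff.2 ⟨?_, ?_⟩⟩
  · exact hρ.Icc_extend'.continuousWithinAt
  · exact hS a b ha hab hb hm u hu

end Manifold

end Cover

end Action

/-! ### The covering space over a Lie groupoid associated with a subgroup -/

namespace Cover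

section LieGroupoid

variable {E : Type*} [NormedAddCommGroup E] [NormedSpace ℝ E]
  {E' : Type*} [NormedAddCommGroup E'] [NormedSpace ℝ E']
  {M : Type u} [TopologicalSpace M] [ChartedSpace E M] [IsManifold 𝓘(ℝ, E) ∞ M]
  {A : Type v} [TopologicalSpace A] [ChartedSpace E' A]
  {G : LieGroupoid E E' M A} {x₀ : M} {H : Subgroup (FundGroup E G.toGpd x₀)}

/-- The coset space as a covering space over the groupoid. -/
noncomputable def coveringSpace (H : Subgroup (FundGroup E G.toGpd x₀))
    (hG : Connected E G.toGpd) : CoveringSpace G (Cover H) where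
  proj := proj
  isCoveringMap := isCoveringMap_proj hG
  surjective x := (hG x₀ x).elim fun p => ⟨mk H p.cls, rfl⟩
  isLocalDiffeomorph := isLocalDiffeomorph_proj
  act := act
  proj_act _ _ h := proj_act h
  act_one := act_one
  act_mul _ _ _ h h' := act_mul h h'
  smooth_act := by
    have : LocallyPathConnectedSpace A := ChartedSpace.locallyPathConnectedSpace E' A
    intro p hp
    -- After projection the action becomes the source of the second component, which is smooth.
    refine contMDiffWithinAt_iff.2 ⟨continuousOn_act G.smooth_src.continuous
      G.smooth_tgt.continuous G.smooth_inv.continuous p hp, ?_⟩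
    refine ((G.smooth_src.comp contMDiff_snd) p).contMDiffWithinAt.congr (fun q hq => ?_) ?_
    · exact proj_act hq
    · exact proj_act hp

/-- Every `G`-path lifts to the covering space. -/
theorem exists_lift_gpath (hG : Connected E G.toGpd) (e : Cover H) {σ : unitInterval → M}
    {l : List (A × (unitInterval → M))} (hc : IsChain E G.toGpd σ l) (h0 : σ 0 = e.proj) :
    ∃ P : RawGPath (Cover H) (coveringSpace H hG).Arrows,
      IsGPath E (coveringSpace H hG).actionGroupoid e (e.ext (GPath.cls ⟨⟨σ, l⟩, hc, h0, rfl⟩)) P ∧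
      (coveringSpace H hG).toHom.mapRaw P = ⟨σ, l⟩ := by
  induction l generalizing e σ with
  | nil =>
    obtain ⟨ρ, h1, h2, h3, h4⟩ := e.exists_lift (G := G.toGpd) hc h0
    have h2' : (fun t => (ρ t).proj) = σ := funext h2
    exact ⟨⟨ρ, []⟩, ⟨piecewiseSmooth_of_proj h1 (by rw [h2']; exact hc), h3, h4⟩,
      RawGPath.ext h2' rfl⟩
  | cons a l ih =>
    obtain ⟨g, τ⟩ := a
    obtain ⟨c1, c2, c3, c4⟩ := id hc
    obtain ⟨ρ, h1, h2, h3, h4⟩ := e.exists_lift (G := G.toGpd) c1 h0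
    have h2' : (fun t => (ρ t).proj) = σ := funext h2
    set e₁ : Cover H := e.ext (pathCls G.toGpd σ c1 h0 rfl)
    obtain ⟨P, hP, hPσ⟩ := ih (e₁.ext (arrCls E G.toGpd g c2 c3)) c4 rfl
    -- The first component of an arrow of the action groupoid is its target: to leave from `e₁` over
    -- `g` one takes the transport of `e₁` along `g`.
    refine ⟨⟨ρ, (⟨(e₁.ext (arrCls E G.toGpd g c2 c3), g), c3.symm⟩, P.head) :: P.tail⟩,
      ⟨⟨piecewiseSmooth_of_proj h1 (by rw [h2']; exact c1), ?_, hP.2.1.symm, hP.1⟩, h3, ?_⟩, ?_⟩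
    · exact (act_ext_arrCls c2 c3).trans h4.symm
    · refine hP.2.2.trans (((ext_ext _ _ _).trans (ext_ext _ _ _)).trans ?_)
      exact congrArg e.ext ((HClass.comp_assoc _ _ _).trans (cls_cons hc h0 rfl).symm)
    · refine RawGPath.ext h2' ?_
      have e1 := congrArg RawGPath.head hPσ
      have e2 := congrArg RawGPath.tail hPσ
      exact congrArg₂ List.cons (congrArg (Prod.mk g) e1) e2

/-- The end point of a path in the covering space is determined by its projection. -/
theorem endOf_eq_ext (hG : Connected E G.toGpd) {ρ : unitInterval → Cover H}
    {l : List ((coveringSpace H hG).Arrows × (unitInterval → Cover H))}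
    (hc : IsChain E (coveringSpace H hG).actionGroupoid ρ l) :
    endOf ρ l = (ρ 0).ext (GPath.cls ⟨(coveringSpace H hG).toHom.mapRaw ⟨ρ, l⟩,
      (coveringSpace H hG).toHom.isChain_map hc, rfl,
      (coveringSpace H hG).toHom.endOf_map _ _⟩) := by
  induction l generalizing ρ with
  | nil => exact end_eq_ext hG hc.1 ((coveringSpace H hG).toHom.isChain_map hc)
  | cons a l ih =>
    obtain ⟨⟨⟨f, g⟩, hg⟩, τ⟩ := a
    obtain ⟨c1, c2, c3, c4⟩ := id hc
    obtain rfl : f = τ 0 := c3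
    have hc' := (coveringSpace H hG).toHom.isChain_map hc
    have hρ : ρ 1 = (ρ 0).ext (pathCls G.toGpd (fun t => (ρ t).proj) hc'.1 rfl rfl) :=
      end_eq_ext hG c1.1 hc'.1
    have hτ : (ρ 1).ext (arrCls E G.toGpd g hc'.2.1 hc'.2.2.1) = τ 0 :=
      ext_arrCls_of_act_eq hg c2 _ _
    refine (ih c4).trans (Eq.symm ?_)
    refine (congrArg (ρ 0).ext (cls_cons hc' rfl
      ((coveringSpace H hG).toHom.endOf_map τ l))).trans ((ext_ext _ _ _).symm.trans ?_)
    refine (ext_ext _ _ _).symm.trans (ext_cls_congr ?_ _ _)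
    exact (ext_arrCls_congr hρ.symm rfl _ _ _ _).trans hτ

/-- The lift from the base point of a representative of a class ends at the coset of that class, so
every point is reached. -/
theorem connected_actionGroupoid (hG : Connected E G.toGpd) :
    Connected E (coveringSpace H hG).actionGroupoid := by
  have key : ∀ e : Cover H, Nonempty (GPath E (coveringSpace H hG).actionGroupoid (base H) e) := by
    intro e
    obtain ⟨x, a, rfl⟩ := e.exists_mk
    induction a using Quot.ind with | _ p
    obtain ⟨⟨σ, l⟩, h1, h2, rfl⟩ := p
    obtain ⟨P, hP, -⟩ := exists_lift_gpath hG (base H) h1 h2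
    have e := base_ext (H := H) (GPath.cls ⟨⟨σ, l⟩, h1, h2, rfl⟩)
    exact ⟨⟨P, e ▸ hP⟩⟩
  intro e e'
  obtain ⟨p⟩ := key e
  obtain ⟨q⟩ := key e'
  exact ⟨p.rev.comp q⟩

theorem range_fundMap (hG : Connected E G.toGpd) (h₀ : (coveringSpace H hG).proj (base H) = x₀) :
    ((coveringSpace H hG).toHom.fundMap (x := base H) (x' := x₀) h₀).range = H := by
  -- `H` is the stabiliser of the base point under transport along loops.
  have hmem : ∀ a : FundGroup E G.toGpd x₀, (base H).ext (y := x₀) a = base H ↔ a ∈ H := by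
    intro a
    refine (iff_of_eq (congrArg (· = base H) (base_ext (H := H) a))).trans
      (eq_comm.trans (mk_eq_mk.trans ?_))
    constructor
    · rintro ⟨h, hh, rfl⟩
      have : HClass.comp h (HClass.one E G.toGpd x₀) = h := HClass.comp_one _
      rw [this]
      exact hh
    · exact fun h => ⟨a, h, (HClass.comp_one _).symm⟩
  ext a
  constructor
  · rintro ⟨b, rfl⟩
    induction b using Quot.ind with | _ P
    obtain ⟨⟨ρ, l⟩, h1, h2, h3⟩ := P
    refine (hmem _).1 ?_
    refine Eq.trans ?_ ((endOf_eq_ext hG h1).symm.trans h3)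
    exact ext_cls_congr h2.symm _ _
  · intro ha
    induction a using Quot.ind with | _ p
    obtain ⟨⟨σ, l⟩, h1, h2, h3⟩ := p
    simp only at h1 h2 h3
    obtain ⟨P, hP, hPσ⟩ := exists_lift_gpath hG (base H) h1 h2
    have he : (base H).ext (GPath.cls ⟨⟨σ, l⟩, h1, h2, rfl⟩) = base H := by
      exact (ext_cls_congr rfl _ _).trans ((hmem _).2 ha)
    rw [he] at hP
    exact ⟨FundGroup.mk ⟨P, hP⟩, congrArg (Quot.mk _) (Subtype.ext hPσ)⟩

end LieGroupoid

end Cover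

/-! ### Second countability -/

namespace Cover

section SecondCountable

variable {E : Type*} [NormedAddCommGroup E] [NormedSpace ℝ E]
  {E' : Type*} [NormedAddCommGroup E'] [NormedSpace ℝ E']
  {M : Type u} [TopologicalSpace M] [ChartedSpace E M]
  {A : Type v} [TopologicalSpace A] [ChartedSpace E' A]
  {G : LieGroupoid E E' M A} {x₀ : M} {H : Subgroup (FundGroup E G.toGpd x₀)}

/-- Only countably many sheets over a countable family of simple open sets meet the image of a
separable space. -/
theorem countable_setOf_sheet_meets {Z : Type*} [TopologicalSpace Z]
    [TopologicalSpace.SeparableSpace Z] {f : Z → Cover H} (hf : Continuous f) {T : Set M}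
    (hT : T.Countable) {U : M → Set M} (hU : ∀ x, IsSimple E (U x)) (hxU : ∀ x, x ∈ U x) :
    {e : Cover H | e.proj ∈ T ∧ ∃ z, f z ∈ sheet (U e.proj) e}.Countable := by
  have h : ∀ x ∈ T, {e : Cover H | e.proj = x ∧ ∃ z, f z ∈ sheet (U x) e}.Countable := by
    intro x _
    -- Distinct points over `x` have disjoint sheets, whose preimages are disjoint nonempty open
    -- subsets of a separable space.
    refine Set.PairwiseDisjoint.countable_of_isOpen (s := fun e => f ⁻¹' sheet (U x) e) ?_
      (fun e _ => (isOpen_sheet (hU x).isOpen e).preimage hf) fun e he => he.2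
    rintro e ⟨he, -⟩ e' ⟨he', -⟩ hne
    refine Set.disjoint_left.2 fun z hz hz' => hne ?_
    have h1 : e' ∈ sheet (U x) e := by
      rw [← sheet_eq_of_mem hz, sheet_eq_of_mem hz']
      exact self_mem_sheet (he' ▸ hxU x)
    exact sheet_injOn (hU x) e (self_mem_sheet (he ▸ hxU x)) h1 (he.trans he'.symm)
  refine Set.Countable.mono (fun e he => ?_) (hT.biUnion h)
  exact Set.mem_iUnion₂.2 ⟨e.proj, he.1, rfl, he.2⟩

variable [IsManifold 𝓘(ℝ, E) ∞ M]

/-- Over a simple set the projection embeds the sheet in `M`. -/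
theorem secondCountableTopology_sheet [SecondCountableTopology M] {U : Set M} (hU : IsSimple E U)
    (e : Cover H) : SecondCountableTopology (sheet U e) := by
  have ho := isOpen_sheet hU.isOpen e
  have : Topology.IsOpenEmbedding ((sheet U e).domRestrict proj) :=
    .of_continuous_injective_isOpenMap (continuous_proj.comp continuous_subtype_val)
      (Set.injOn_iff_injective.1 (sheet_injOn hU e)) (isOpenMap_proj.comp ho.isOpenMap_subtype_val)
  exact this.isEmbedding.secondCountableTopology

/-- A path cannot leave a clopen set, and the arrows cannot leave an invariant one. -/
theorem mem_of_isChain (hG : Connected E G.toGpd) {Q : Set (Cover H)} (hQ : IsClopen Q)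
    (hact : ∀ e ∈ Q, ∀ g, e.proj = G.tgt g → e.act g ∈ Q) {ρ : unitInterval → Cover H}
    {l : List ((coveringSpace H hG).Arrows × (unitInterval → Cover H))}
    (hc : IsChain E (coveringSpace H hG).actionGroupoid ρ l) (h0 : ρ 0 ∈ Q) : endOf ρ l ∈ Q := by
  have hpath : ∀ {ρ : unitInterval → Cover H}, Continuous ρ → ρ 0 ∈ Q → ρ 1 ∈ Q := by
    intro ρ hρ h0
    exact Set.eq_univ_iff_forall.1 ((hQ.preimage hρ).eq_univ ⟨0, h0⟩) 1
  induction l generalizing ρ with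
  | nil => exact hpath hc.1 h0
  | cons a l ih =>
    obtain ⟨⟨⟨f, g⟩, hg⟩, τ⟩ := a
    obtain ⟨c1, c2, c3, c4⟩ := hc
    obtain rfl : f = τ 0 := c3
    refine ih c4 ?_
    have hg' : (τ 0).proj = G.tgt g := hg
    have c2' : (τ 0).act g = ρ 1 := c2
    -- The action goes from target to source, so following the arrow forwards means acting by the
    -- inverse of `g`.
    have h1 := hact _ (hpath c1.1 h0) (G.inv g) (by rw [← c2', proj_act hg', G.tgt_inv])
    rwa [← c2', act_mul hg' (G.tgt_inv g).symm, G.mul_inv, ← hg', act_one] at h1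

/-- A connectedness argument that must follow arrows as well as paths: `F` itself need not be
connected, so the sheets are counted by steps which act by arbitrary arrows. -/
theorem secondCountableTopology (hG : Connected E G.toGpd) [SecondCountableTopology M]
    [SecondCountableTopology A] : SecondCountableTopology (Cover H) := by
  have : LocallyPathConnectedSpace A := ChartedSpace.locallyPathConnectedSpace E' A
  choose U hU hxU _ using fun x : M => exists_isSimple E isOpen_univ (Set.mem_univ x)
  -- Countably many simple sets cover `M`; only sheets centred over points of `T` are counted.
  obtain ⟨T, hT, hTU⟩ := TopologicalSpace.isOpen_iUnion_countable U fun x => (hU x).isOpen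
  have hcov : ∀ y : M, ∃ x ∈ T, y ∈ U x := by
    intro y
    have : y ∈ ⋃ x ∈ T, U x := hTU ▸ Set.mem_iUnion.2 ⟨y, hxU y⟩
    simpa using this
  have hsheet : ∀ p : Cover H, ∃ e : Cover H, e.proj ∈ T ∧ p ∈ sheet (U e.proj) e := by
    intro p
    obtain ⟨x, hx, hp⟩ := hcov p.proj
    obtain ⟨c, hc⟩ := (hU x).exists_inside G.toGpd hp (hxU x)
    refine ⟨p.ext c, hx, ?_⟩
    change p ∈ sheet (U x) (p.ext c)
    rw [sheet_eq_of_mem (ext_mem_sheet hc)]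
    exact self_mem_sheet hp
  -- The centres of the sheets met when all arrows act on the sheet of `f`. Unit arrows are
  -- included, so overlapping sheets are among them.
  let next (f : Cover H) : Set (Cover H) := {e | e.proj ∈ T ∧
    ∃ z : {z : sheet (U f.proj) f × A // z.1.1.proj = G.tgt z.2},
      z.1.1.1.act z.1.2 ∈ sheet (U e.proj) e}
  have hnext : ∀ f, (next f).Countable := by
    intro f
    have := secondCountableTopology_sheet (hU f.proj) f
    have : SecondCountableTopology {z : sheet (U f.proj) f × A // z.1.1.proj = G.tgt z.2} :=
      Topology.IsEmbedding.subtypeVal.secondCountableTopology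
    refine countable_setOf_sheet_meets (Z := {z : sheet (U f.proj) f × A //
      z.1.1.proj = G.tgt z.2}) (f := fun z => z.1.1.1.act z.1.2) ?_ hT hU hxU
    exact continuousOn_act G.smooth_src.continuous G.smooth_tgt.continuous
      G.smooth_inv.continuous
      |>.comp_continuous (f := fun z : {z : sheet (U f.proj) f × A // z.1.1.proj = G.tgt z.2} =>
        ((z.1.1.1, z.1.2) : Cover H × A)) (by fun_prop) fun z => z.2
  obtain ⟨b, hbT, hb⟩ := hsheet (base H)
  -- Centres reached in exactly `n` steps from a sheet containing the base point.
  let C (n : ℕ) : Set (Cover H) := Nat.rec {b} (fun _ S => ⋃ f ∈ S, next f) n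
  have hC : ∀ n, (C n).Countable := by
    intro n
    induction n with
    | zero => exact Set.countable_singleton b
    | succ n ih => exact ih.biUnion fun f _ => hnext f
  set D := ⋃ n, C n with hD
  have hDc : D.Countable := Set.countable_iUnion hC
  have hstep : ∀ f ∈ D, next f ⊆ D := by
    intro f hf e he
    obtain ⟨n, hn⟩ := Set.mem_iUnion.1 hf
    exact Set.mem_iUnion.2 ⟨n + 1, Set.mem_iUnion₂.2 ⟨f, hn, he⟩⟩
  set Q := ⋃ e ∈ D, sheet (U e.proj) e with hQ
  have hact' : ∀ p ∈ Q, ∀ g, p.proj = G.tgt g → ∀ e : Cover H, e.proj ∈ T →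
      p.act g ∈ sheet (U e.proj) e → e ∈ D := by
    intro p hp g hg e heT he
    obtain ⟨f, hf, hpf⟩ := Set.mem_iUnion₂.1 hp
    exact hstep f hf ⟨heT, ⟨(⟨p, hpf⟩, g), hg⟩, he⟩
  have hmeet : ∀ p ∈ Q, ∀ e : Cover H, e.proj ∈ T → p ∈ sheet (U e.proj) e → e ∈ D := by
    intro p hp e heT he
    refine hact' p hp (G.one p.proj) (G.tgt_one _).symm e heT ?_
    rwa [act_one]
  have hopen : IsOpen Q :=
    isOpen_biUnion fun e _ => isOpen_sheet (hU e.proj).isOpen e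
  have hclosed : IsClosed Q := by
    refine ⟨isOpen_iff_mem_nhds.2 fun p hp => ?_⟩
    obtain ⟨e, heT, he⟩ := hsheet p
    refine Filter.mem_of_superset ((isOpen_sheet (hU e.proj).isOpen e).mem_nhds he) ?_
    -- If a sheet around `p` met `Q`, its centre would lie in `D` and `p` in `Q`; so the complement
    -- of `Q` is open.
    exact fun q hq hqQ => hp (Set.mem_iUnion₂.2 ⟨e, hmeet q hqQ e heT hq, he⟩)
  have hact : ∀ p ∈ Q, ∀ g, p.proj = G.tgt g → p.act g ∈ Q := by
    intro p hp g hg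
    obtain ⟨e, heT, he⟩ := hsheet (p.act g)
    exact Set.mem_iUnion₂.2 ⟨e, hact' p hp g hg e heT he, he⟩
  have hbase : base H ∈ Q := Set.mem_iUnion₂.2 ⟨b, Set.mem_iUnion.2 ⟨0, rfl⟩, hb⟩
  have huniv : Q = Set.univ := by
    refine Set.eq_univ_of_forall fun e => ?_
    obtain ⟨P, h1, h2, h3⟩ := connected_actionGroupoid hG (base H) e
    rw [← h3]
    exact mem_of_isChain hG ⟨hclosed, hopen⟩ hact h1 (h2 ▸ hbase)
  have := hDc.to_subtype
  have (e : D) : SecondCountableTopology (sheet (U e.1.proj) e.1) :=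
    secondCountableTopology_sheet (hU e.1.proj) e.1
  refine TopologicalSpace.secondCountableTopology_of_countable_cover
    (U := fun e : D => sheet (U e.1.proj) e.1)
    (fun e => isOpen_sheet (hU e.1.proj).isOpen e.1) ?_
  rw [← huniv, hQ, Set.biUnion_eq_iUnion]

end SecondCountable

end Cover

end LieGpd

theorem mainTheorem3
    {E : Type*} [NormedAddCommGroup E] [NormedSpace ℝ E] [FiniteDimensional ℝ E]
    {E' : Type*} [NormedAddCommGroup E'] [NormedSpace ℝ E'] [FiniteDimensional ℝ E']
    {M : Type u} [TopologicalSpace M] [T2Space M] [ChartedSpace E M] [IsManifold 𝓘(ℝ, E) ∞ M]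
    {A : Type v} [TopologicalSpace A] [ChartedSpace E' A] [IsManifold 𝓘(ℝ, E') ∞ A]
    (G : LieGpd.LieGroupoid E E' M A) (hG : LieGpd.Connected E G.toGpd) (x₀ : M)
    (H : Subgroup (LieGpd.FundGroup E G.toGpd x₀)) :
    ∃ (F : Type (max u v)) (_ : TopologicalSpace F) (_ : T2Space F) (_ : ChartedSpace E F)
      (_ : IsManifold 𝓘(ℝ, E) ∞ F) (C : LieGpd.CoveringSpace G F) (e₀ : F) (h₀ : C.proj e₀ = x₀),
      (SecondCountableTopology M → SecondCountableTopology A → SecondCountableTopology F) ∧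
      LieGpd.Connected E C.actionGroupoid ∧
      (C.toHom.fundMap h₀).range = H := by
  exact ⟨LieGpd.Cover H, inferInstance, LieGpd.Cover.t2Space hG, inferInstance, inferInstance,
    LieGpd.Cover.coveringSpace H hG, LieGpd.Cover.base H, rfl,
    fun _ _ => LieGpd.Cover.secondCountableTopology hG, LieGpd.Cover.connected_actionGroupoid hG,
    LieGpd.Cover.range_fundMap hG rfl⟩
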